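/- **Setting.** Let $d\ge 1$, $\mathbb T^d=\mathbb R^d/(2\pi\mathbb Z)^d$, $e_\xi(x)=(2\pi)^{-d/2}e^{i\xi\cdot x}$, $\widehat f(\xi)=\int_{\mathbb T^d} f\,\overline{e_\xi}\,dx$, and $e^{t\Delta}f=\sum_{\xi\in\mathbb Z^d}e^{-t|\xi|^2}\widehat f(\xi)e_\xi$. Let $R,M,L,T>0$ and $\delta<1$ satisfy $R+TLM\le M$ and $TL\le\delta$. Put $Q_T=\mathbb T^d\times(0,T)$ and $$U_{0,R}=\{u_0\in C(\mathbb T^d;\mathbb R):\|u_0\|_{L^\infty}\le R\},\qquad U_M=\{u\in C([0,T];C(\mathbb T^d;\mathbb R)):\|u\|_{L^\infty(Q_T)}\le M\},$$ $$\mathcal F_{M,L}=\{F:[-M,M]\to\mathbb R:\ F(0)=0,\ \mathrm{Lip}_{[-M,M]}(F)\le L\}.$$ Let $s_0>d/2$, $R_0\ge 0$ and let $U_0=\{u_0\in H^{s_0}(\mathbb T^d):\|u_0\|_{H^{s_0}}\le R_0\}$, where $\|f\|_{H^{s}}^2=\sum_\xi(1+|\xi|^2)^{s}|\widehat f(\xi)|^2$,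 and assume $U_0\subset U_{0,R}$. For $F\in\mathcal F_{M,L}$ and $u_0\in U_{0,R}$ let $$\mathcal T_{F,u_0}[v](t)=e^{t\Delta}u_0+\int_0^te^{(t-\tau)\Delta}F(v(\tau))\,d\tau ;$$ let $\mathcal T_{F,u_0}^{[\ell]}[0]$ be its $\ell$-th iterate started at $0$ and $\mathcal G_F(u_0)\in U_M$ its unique fixed point in $U_M$ (these are well defined, and the iterates lie in $U_M$). A one-dimensional ReLU network is a fully connected feedforward ReLU network $\rho:\mathbb R\to\mathbb R$; its size $H(\rho)$ is the total number of its weights and biases. For $N\in\mathbb N$ let $P_Nf=\sum_{|\xi_r|\le N}\prod_{r=1}^d\bigl(1-\tfrac{|\xi_r|}{N+1}\bigr)_+\widehat f(\xi)e_\xi$ be the Fejér cutoff and $S_N(t)=P_Ne^{t\Delta}$. The $\ell$-step Picard-type Fourier neural operator is $\Gamma^{\rm FNO}_{N,\ell,\rho}(u_0)=u^{(\ell)}$, where $u^{(0)}=0$ and $u^{(j+1)}(t)=S_N(t)u_0+\int_0^tS_N(t-\tau)\rho(u^{(j)}(\tau))\,d\tau$. Let $\Pi$ be a probability measure on initial data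 supported on $U_0$, $\mu$ a probability measure on $Q_T$, $F_\ast\in\mathcal F_{M,L}$, and $\mathcal L[\Gamma]=\mathbb E_{u_0\sim\Pi,\,z\sim\mu}|\Gamma(u_0)(z)-\mathcal G_{F_\ast}(u_0)(z)|^2$. For a family $(\rho_F)_{F\in\mathcal F_{M,L}}$ of networks put $$\varepsilon^{\rm FNO}_{\rm imp}(N,\ell,\eta)=\sup_{F\in\mathcal F_{M,L}}\bigl|\mathcal L[\Gamma^{\rm FNO}_{N,\ell,\rho_F}]-\mathcal L[b_{F,\ell}]\bigr|,\qquad b_{F,\ell}(u_0)=\mathcal T_{F,u_0}^{[\ell]}[0].$$ **Theorem 6.2.** There is a universal constant $C>0$ such that, in the setting above, the following hold. (i) For every $\eta\in(0,1)$ and $F\in\mathcal F_{M,L}$ there is a one-dimensional ReLU network $\rho_F$ with $$\|F-\rho_F\|_{L^\infty([-M,M])}\le\eta,\quad \rho_F(0)=0,\quad \mathrm{Lip}_{[-M,M]}(\rho_F)\le L,\tag{1}$$ and $H(\rho_F)\le C(1+ML\eta^{-1})$. (ii) For each $\ell\in\mathbb N$ there is a sequence $a_N(\ell)\to0$ as $N\to\infty$,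 independent of $\eta$, of the choice of networks, and of $\Pi,\mu,F_\ast$, such that for all $\eta\in(0,1)$, all families $(\rho_F)_{F\in\mathcal F_{M,L}}$ of networks satisfying (1), and all $N$: $\Gamma^{\rm FNO}_{N,\ell,\rho_F}$ maps $U_{0,R}$ (hence $U_0$) into $U_M$ for every $F\in\mathcal F_{M,L}$, $$\sup_{F\in\mathcal F_{M,L}}\ \sup_{u_0\in U_0}\bigl\|\Gamma^{\rm FNO}_{N,\ell,\rho_F}(u_0)-\mathcal T_{F,u_0}^{[\ell]}[0]\bigr\|_{L^\infty(Q_T)}\le\frac{1-\delta^\ell}{1-\delta}T\eta+a_N(\ell),$$ and consequently, for all $\Pi,\mu,F_\ast$ as above, the risks are finite and $$\varepsilon^{\rm FNO}_{\rm imp}(N,\ell,\eta)\le4M\Bigl\{\frac{1-\delta^\ell}{1-\delta}T\eta+a_N(\ell)\Bigr\}.$$ (iii) In particular the implementation error can be made arbitrarily small: for every $\varepsilon>0$ there is $\eta_0\in(0,1)$ such that for all $\eta\in(0,\eta_0]$ and all $\ell$ there is $N_0$ such that $\varepsilon^{\rm FNO}_{\rm imp}(N,\ell,\eta)\le\varepsilon$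 for all $N\ge N_0$, all families of networks satisfying (1), and all $\Pi,\mu,F_\ast$ as above. -/

import Mathlib

open MeasureTheory Filter Topology
open scoped ENNReal Real ComplexConjugate

namespace PicardFNO

instance factTwoPiPos : Fact (0 < 2 * π) := ⟨Real.two_pi_pos⟩

/-- The torus `𝕋ᵈ = ℝᵈ / (2πℤ)ᵈ`. Its `volume` is Lebesgue measure, of total mass `(2π)ᵈ`. -/
abbrev Torus (d : ℕ) : Type := Fin d → AddCircle (2 * π)

/-- `C(𝕋ᵈ)` carries the sup norm and the Borel σ-algebra of the corresponding topology. -/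
noncomputable instance measurableSpaceC (d : ℕ) : MeasurableSpace C(Torus d, ℝ) := borel _

instance borelSpaceC (d : ℕ) : BorelSpace C(Torus d, ℝ) := ⟨rfl⟩

/-! ### Fourier analysis on the torus -/

/-- `e_ξ(x) = (2π)^{-d/2} exp(i ξ·x)`. Mathlib's monomial `fourier n` on `ℝ / 2πℤ` is
`x ↦ exp(i n x)`. -/
noncomputable def e {d : ℕ} (ξ : Fin d → ℤ) (x : Torus d) : ℂ :=
  (((2 * π) ^ (-(d : ℝ) / 2) : ℝ) : ℂ) * ∏ r, fourier (ξ r) (x r)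

/-- The Fourier coefficient `∫ f(x) conj(e_ξ(x)) dx`. -/
noncomputable def coeff {d : ℕ} (f : Torus d → ℝ) (ξ : Fin d → ℤ) : ℂ :=
  ∫ x, (f x : ℂ) * conj (e ξ x)

/-- `|ξ|²`. -/
def freqSq {d : ℕ} (ξ : Fin d → ℤ) : ℝ := ∑ r, (ξ r : ℝ) ^ 2

/-- The heat semigroup `e^{tΔ} f = ∑ e^{-t|ξ|²} f̂(ξ) e_ξ`, acting on real functions. For `t > 0`
the series converges absolutely for integrable `f` and its value is real. At `t = 0` the operator
is the identity; this is written separately because the pointwise Fourier series of a continuous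
function need not converge. -/
noncomputable def heat {d : ℕ} (t : ℝ) (f : Torus d → ℝ) (x : Torus d) : ℝ :=
  if t = 0 then f x
  else (∑' ξ : Fin d → ℤ, (Real.exp (-t * freqSq ξ) : ℂ) * coeff f ξ * e ξ x).re

/-- The Fejér symbol `∏ (1 - |ξ_r| / (N + 1))₊`. -/
noncomputable def fejerSymbol {d : ℕ} (N : ℕ) (ξ : Fin d → ℤ) : ℝ :=
  ∏ r, max (1 - |(ξ r : ℝ)| / ((N : ℝ) + 1)) 0

/-- The frequencies `ξ` with `|ξ_r| ≤ N` for all `r`. -/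
noncomputable def freqBox (d N : ℕ) : Finset (Fin d → ℤ) :=
  Fintype.piFinset fun _ => Finset.Icc (-(N : ℤ)) (N : ℤ)

/-- The tensor-product Fejér cutoff `P_N f = ∑ m_N(ξ) f̂(ξ) e_ξ`. The symbol is even, so the value
is real for real `f`. -/
noncomputable def fejer {d : ℕ} (N : ℕ) (f : Torus d → ℝ) (x : Torus d) : ℝ :=
  (∑ ξ ∈ freqBox d N, (fejerSymbol N ξ : ℂ) * coeff f ξ * e ξ x).re

/-- The truncated heat semigroup `S_N(t) = P_N e^{tΔ}`. -/
noncomputable def truncHeat {d : ℕ} (N : ℕ) (t : ℝ) (f : Torus d → ℝ) : Torus d → ℝ :=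
  fejer N (heat t f)

/-! ### Function classes -/

/-- The norm `‖f‖_{H^s} = (∑ (1 + |ξ|²)^s |f̂(ξ)|²)^{1/2} ∈ [0, ∞]`. -/
noncomputable def sobolevNorm {d : ℕ} (s : ℝ) (f : Torus d → ℝ) : ℝ≥0∞ :=
  (∑' ξ : Fin d → ℤ, ENNReal.ofReal ((1 + freqSq ξ) ^ s * ‖coeff f ξ‖ ^ 2)) ^ (1 / 2 : ℝ)

/-- The ball `U_0 = {‖u₀‖_{H^{s₀}} ≤ R₀}`. It is used for `s₀ > d/2` only, when each element of
`H^{s₀}(𝕋ᵈ)` has exactly one continuous representative. -/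
def sobolevBall (d : ℕ) (s₀ R₀ : ℝ) : Set C(Torus d, ℝ) :=
  {u₀ | sobolevNorm s₀ u₀ ≤ ENNReal.ofReal R₀}

/-- `U_{0,R} = {u₀ ∈ C(𝕋ᵈ) : ‖u₀‖_{L^∞} ≤ R}`. -/
def initialBall (d : ℕ) (R : ℝ) : Set C(Torus d, ℝ) := {u₀ | ‖u₀‖ ≤ R}

/-- `U_M = {u ∈ C([0,T]; C(𝕋ᵈ)) : ‖u‖_{L^∞(Q_T)} ≤ M}`. Space-time functions are written
`u t x`, only the values for `t ∈ [0,T]` matter, and `C([0,T]; C(𝕋ᵈ)) = C([0,T] × 𝕋ᵈ)` since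
`𝕋ᵈ` is compact. For continuous `u` the essential supremum over `Q_T` is the supremum over
`[0,T] × 𝕋ᵈ`. -/
def solutionBall (d : ℕ) (T M : ℝ) : Set (ℝ → Torus d → ℝ) :=
  {u | ContinuousOn (fun p : ℝ × Torus d => u p.1 p.2) (Set.Icc 0 T ×ˢ Set.univ) ∧
    ∀ t ∈ Set.Icc 0 T, ∀ x, |u t x| ≤ M}

/-- `F(0) = 0` and `Lip_{[-M,M]}(F) ≤ L`. A function on `[-M,M]` is represented by any extension
of it to `ℝ`; the values outside `[-M,M]` are unconstrained and never used on `U_M`. -/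
def nonlinClass (M L : ℝ) : Set (ℝ → ℝ) :=
  {F | F 0 = 0 ∧
    ∀ y ∈ Set.Icc (-M) M, ∀ z ∈ Set.Icc (-M) M, |F y - F z| ≤ L * |y - z|}

/-! ### ReLU networks -/

/-- Fully connected ReLU networks with `n` inputs, one scalar output and any number of hidden
layers of any widths: an affine output layer, or a hidden layer `y ↦ ReLU(W y + b)` of width `m`
followed by a network with `m` inputs. -/
inductive ReLUNet : ℕ → Type
  | output {n : ℕ} (w : Fin n → ℝ) (b : ℝ) : ReLUNet n
  | hidden {n m : ℕ} (W : Matrix (Fin m) (Fin n) ℝ) (b : Fin m → ℝ) (rest : ReLUNet m) : ReLUNet n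

/-- The function computed by a network. -/
def ReLUNet.eval : {n : ℕ} → ReLUNet n → (Fin n → ℝ) → ℝ
  | _, .output w b, y => w ⬝ᵥ y + b
  | _, .hidden W b rest, y => rest.eval fun i => max ((W.mulVec y + b) i) 0

/-- The size: the total number of weights and biases of all layers, zero entries included. -/
def ReLUNet.size : {n : ℕ} → ReLUNet n → ℕ
  | n, .output _ _ => n + 1
  | n, .hidden (m := m) _ _ rest => m * n + m + rest.size

/-- The function `ℝ → ℝ` realized by a network with one input. -/
def ReLUNet.fn (ρ : ReLUNet 1) (y : ℝ) : ℝ := ρ.eval fun _ => y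

/-- `‖F - ρ‖_{L^∞([-M,M])} ≤ η`, `ρ(0) = 0` and `Lip_{[-M,M]}(ρ) ≤ L`. -/
def Approximates (M L η : ℝ) (F : ℝ → ℝ) (ρ : ReLUNet 1) : Prop :=
  (∀ y ∈ Set.Icc (-M) M, |F y - ρ.fn y| ≤ η) ∧ ρ.fn 0 = 0 ∧
    ∀ y ∈ Set.Icc (-M) M, ∀ z ∈ Set.Icc (-M) M, |ρ.fn y - ρ.fn z| ≤ L * |y - z|

/-! ### Picard iteration and its Fourier neural operator -/

/-- `𝒯_{F,u₀}[v](t) = e^{tΔ} u₀ + ∫₀ᵗ e^{(t-τ)Δ} F(v(τ)) dτ`. -/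
noncomputable def picardMap {d : ℕ} (F : ℝ → ℝ) (u₀ : C(Torus d, ℝ)) (v : ℝ → Torus d → ℝ) :
    ℝ → Torus d → ℝ :=
  fun t x => heat t u₀ x + ∫ τ in (0 : ℝ)..t, heat (t - τ) (fun y => F (v τ y)) x

/-- The exact Picard iterate `𝒯_{F,u₀}^{[ℓ]}[0]`. -/
noncomputable def picardIter {d : ℕ} (F : ℝ → ℝ) (ℓ : ℕ) (u₀ : C(Torus d, ℝ)) :
    ℝ → Torus d → ℝ :=
  (picardMap F u₀)^[ℓ] 0

/-- `𝒯^N_{ρ,u₀}[v](t) = S_N(t) u₀ + ∫₀ᵗ S_N(t-τ) ρ(v(τ)) dτ`. -/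
noncomputable def truncPicardMap {d : ℕ} (N : ℕ) (ρ : ℝ → ℝ) (u₀ : C(Torus d, ℝ))
    (v : ℝ → Torus d → ℝ) : ℝ → Torus d → ℝ :=
  fun t x => truncHeat N t u₀ x + ∫ τ in (0 : ℝ)..t, truncHeat N (t - τ) (fun y => ρ (v τ y)) x

/-- The `ℓ`-step Picard-type Fourier neural operator `u₀ ↦ (𝒯^N_{ρ,u₀})^{[ℓ]}[0]`. -/
noncomputable def fno {d : ℕ} (N ℓ : ℕ) (ρ : ReLUNet 1) (u₀ : C(Torus d, ℝ)) :
    ℝ → Torus d → ℝ :=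
  (truncPicardMap N ρ.fn u₀)^[ℓ] 0

/-- `u ∈ U_M` is a mild solution on `[0,T]` of `∂ₜu - Δu = F(u)`, `u(0) = u₀`. -/
def IsMildSolution {d : ℕ} (T M : ℝ) (F : ℝ → ℝ) (u₀ : C(Torus d, ℝ))
    (u : ℝ → Torus d → ℝ) : Prop :=
  u ∈ solutionBall d T M ∧ ∀ t ∈ Set.Icc 0 T, ∀ x, u t x = picardMap F u₀ u t x

open Classical in
/-- The solution operator `𝒢_F`, sending `u₀` to its mild solution in `U_M`. -/
noncomputable def solOp {d : ℕ} (T M : ℝ) (F : ℝ → ℝ) (u₀ : C(Torus d, ℝ)) :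
    ℝ → Torus d → ℝ :=
  if h : ∃ u, IsMildSolution T M F u₀ u then h.choose else 0

/-! ### Risk and implementation error -/

/-- The space-time cylinder `Q_T = 𝕋ᵈ × (0,T)`. -/
def cylinder (d : ℕ) (T : ℝ) : Set (Torus d × ℝ) := Set.univ ×ˢ Set.Ioo 0 T

/-- The squared error `|Γ(u₀)(z) - G(u₀)(z)|²` at `z = (x,t)`. -/
def sqErr {d : ℕ} (Γ G : C(Torus d, ℝ) → ℝ → Torus d → ℝ)
    (p : C(Torus d, ℝ) × (Torus d × ℝ)) : ℝ :=
  |Γ p.1 p.2.2 p.2.1 - G p.1 p.2.2 p.2.1| ^ 2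

/-- The population risk `E_{u₀∼Π, z∼μ} |Γ(u₀)(z) - G(u₀)(z)|²` with respect to the target `G`. -/
noncomputable def risk {d : ℕ} (P : Measure C(Torus d, ℝ)) (μ : Measure (Torus d × ℝ))
    (G Γ : C(Torus d, ℝ) → ℝ → Torus d → ℝ) : ℝ :=
  ∫ p, sqErr Γ G p ∂(P.prod μ)

/-- The implementation error: the supremum over `F` in the class of the difference between the
risk of the neural operator with network `ρ F` and the risk of the `ℓ`-step Picard iterate for
`F`. -/
noncomputable def implError {d : ℕ} (M L : ℝ) (P : Measure C(Torus d, ℝ))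
    (μ : Measure (Torus d × ℝ)) (G : C(Torus d, ℝ) → ℝ → Torus d → ℝ) (N ℓ : ℕ)
    (ρ : (ℝ → ℝ) → ReLUNet 1) : ℝ≥0∞ :=
  ⨆ F ∈ nonlinClass M L,
    ENNReal.ofReal |risk P μ G (fno N ℓ (ρ F)) - risk P μ G (picardIter F ℓ)|

/-- `Π` is a probability measure on initial data supported on `U_0`, and `μ` is a probability
measure on `Q_T`. -/
def IsDataLaw {d : ℕ} (s₀ R₀ T : ℝ) (P : Measure C(Torus d, ℝ))
    (μ : Measure (Torus d × ℝ)) : Prop :=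
  IsProbabilityMeasure P ∧ P (sobolevBall d s₀ R₀)ᶜ = 0 ∧
    IsProbabilityMeasure μ ∧ μ (cylinder d T)ᶜ = 0

end PicardFNO

open PicardFNO

/-! The Fejér and heat kernels are probability measures, so `heat t` and `truncHeat N t` average a
function over random shifts by h + √(2t) z, with z standard Gaussian, and with h = 0 in the first
case and h Fejér distributed in the second (`heat_eq`, `truncHeat_eq`). Both Picard maps are
therefore cases of `avgPicard ν` for a probability measure ν. Averaging commutes with translations
and does not increase sup norms, so invariance of the ball of radius M and the contraction factor δ
hold with the same constants for all N.

The cutoff only adds the shift h, and costs at most the Fejér mean of a translation modulus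
(`heatAvg_sub_dirac`). The iterates inherit the modulus of the initial datum up to the factor (1 -
δ)⁻¹ (`avgIter_modulus`), so no regularity of F beyond the Lipschitz bound enters. On a Sobolev ball
with s > d/2 the modulus is uniform, and its Fejér mean B tends to zero (`exists_cutoff_bound`). The
errors obey E_{ℓ+1} ≤ δ E_ℓ + Tη + (1 - δ)⁻¹ B (`avgIter_error`); summing the geometric series gives
the uniform estimate.

The networks are piecewise linear interpolants on a grid containing 0 (`exists_approximates`). For
the risks, a² - b² = (a + b)(a - b) with |a + b| ≤ 4M (`abs_risk_sub_le`); integrability rests on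
joint continuity in datum and space-time point. -/

namespace PicardFNO

/-! ### Characters of the torus -/

/-- The character `χ_ξ(x) = exp(i ξ·x)` of the torus. -/
noncomputable def chi {d : ℕ} (ξ : Fin d → ℤ) : C(Torus d, ℂ) where
  toFun x := ∏ r, fourier (ξ r) (x r)
  continuous_toFun := by fun_prop

lemma chi_apply {d : ℕ} (ξ : Fin d → ℤ) (x : Torus d) :
    chi ξ x = ∏ r, fourier (ξ r) (x r) := rfl

lemma chi_zero_index {d : ℕ} (x : Torus d) : chi (0 : Fin d → ℤ) x = 1 := by
  simp [chi_apply]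

lemma chi_neg_index {d : ℕ} (ξ : Fin d → ℤ) (x : Torus d) : chi (-ξ) x = conj (chi ξ x) := by
  simp [chi_apply, map_prod]

lemma chi_add_index {d : ℕ} (ξ ζ : Fin d → ℤ) (x : Torus d) :
    chi (ξ + ζ) x = chi ξ x * chi ζ x := by
  simp only [chi_apply, Pi.add_apply, fourier_add, Finset.prod_mul_distrib]

lemma chi_add {d : ℕ} (ξ : Fin d → ℤ) (x y : Torus d) :
    chi ξ (x + y) = chi ξ x * chi ξ y := by
  simp only [chi_apply, Pi.add_apply, fourier_apply, smul_add, AddCircle.toCircle_add,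
    Circle.coe_mul, Finset.prod_mul_distrib]

lemma norm_chi {d : ℕ} (ξ : Fin d → ℤ) (x : Torus d) : ‖chi ξ x‖ = 1 := by
  rw [chi_apply, norm_prod]
  exact Finset.prod_eq_one fun r _ => by rw [fourier_apply]; exact Circle.norm_coe _

lemma chi_mul_conj {d : ℕ} (ξ : Fin d → ℤ) (x : Torus d) : chi ξ x * conj (chi ξ x) = 1 := by
  rw [Complex.mul_conj, Complex.normSq_eq_norm_sq, norm_chi]; simp

lemma chi_sub {d : ℕ} (ξ : Fin d → ℤ) (x y : Torus d) :
    chi ξ (x - y) = chi ξ x * conj (chi ξ y) := by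
  have h := chi_add ξ (x - y) y
  rw [sub_add_cancel] at h
  rw [h, mul_assoc, chi_mul_conj, mul_one]

lemma integral_haar_fourier (n : ℤ) :
    ∫ x : AddCircle (2 * π), fourier n x ∂AddCircle.haarAddCircle = if n = 0 then 1 else 0 := by
  have := congr_fun (fourierCoeff_fourier (T := 2 * π) n) 0
  rw [fourierCoeff] at this
  simpa [Pi.single_apply, eq_comm] using this

lemma integral_fourier (n : ℤ) :
    ∫ x : AddCircle (2 * π), fourier n x = if n = 0 then ((2 * π : ℝ) : ℂ) else 0 := by
  rw [AddCircle.volume_eq_smul_haarAddCircle, integral_smul_measure, integral_haar_fourier,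
    ENNReal.toReal_ofReal Real.two_pi_pos.le]
  split_ifs <;> simp

lemma integral_chi {d : ℕ} (ξ : Fin d → ℤ) :
    ∫ x : Torus d, chi ξ x = if ξ = 0 then (((2 * π) ^ d : ℝ) : ℂ) else 0 := by
  simp only [chi_apply]
  rw [integral_fintype_prod_volume_eq_prod (fun r (x : AddCircle (2 * π)) => fourier (ξ r) x)]
  simp only [integral_fourier]
  split_ifs with h
  · subst h; simp
  · obtain ⟨r, hr⟩ := Function.ne_iff.mp h
    exact Finset.prod_eq_zero (Finset.mem_univ r) (by simpa using hr)

/-- The normalization `(2π)^{-d/2}` of the basis functions. -/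
noncomputable def nrm (d : ℕ) : ℝ := (2 * π) ^ (-(d : ℝ) / 2)

lemma nrm_pos (d : ℕ) : 0 < nrm d := Real.rpow_pos_of_pos Real.two_pi_pos _

lemma nrm_sq (d : ℕ) : nrm d * nrm d * (2 * π) ^ d = 1 := by
  rw [nrm, ← Real.rpow_add Real.two_pi_pos, ← Real.rpow_natCast,
    ← Real.rpow_add Real.two_pi_pos]
  ring_nf
  simp

lemma e_eq {d : ℕ} (ξ : Fin d → ℤ) (x : Torus d) : e ξ x = (nrm d : ℂ) * chi ξ x := rfl

lemma norm_e {d : ℕ} (ξ : Fin d → ℤ) (x : Torus d) : ‖e ξ x‖ = nrm d := by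
  rw [e_eq, norm_mul, norm_chi, mul_one, Complex.norm_real, Real.norm_of_nonneg (nrm_pos d).le]

/-! ### Uniqueness of Fourier coefficients -/

/-- The star algebra of trigonometric polynomials. -/
noncomputable def trigPoly (d : ℕ) : StarSubalgebra ℂ C(Torus d, ℂ) where
  toSubalgebra := Algebra.adjoin ℂ (Set.range chi)
  star_mem' := by
    change Algebra.adjoin ℂ (Set.range chi) ≤ star (Algebra.adjoin ℂ (Set.range chi))
    refine Algebra.adjoin_le ?_
    rintro _ ⟨n, rfl⟩
    refine Algebra.subset_adjoin ⟨-n, ?_⟩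
    ext1 x
    simp only [chi_neg_index, starRingEnd_apply, ContinuousMap.star_apply]

/-- Characters are closed under multiplication and include 1, so generating an algebra adds nothing
to their linear span. -/
lemma trigPoly_coe (d : ℕ) :
    (trigPoly d).toSubalgebra.toSubmodule = Submodule.span ℂ (Set.range chi) := by
  apply Algebra.adjoin_eq_span_of_subset
  refine .trans (fun x ↦ Submonoid.closure_induction (fun _ ↦ id) ⟨0, ?_⟩ ?_) Submodule.subset_span
  · ext z
    simp [chi_zero_index]
  · rintro _ _ _ _ ⟨m, rfl⟩ ⟨n, rfl⟩
    exact ⟨m + n, by ext z; simp [chi_add_index]⟩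

lemma trigPoly_separatesPoints (d : ℕ) : (trigPoly d).SeparatesPoints := by
  classical
  intro x y hxy
  rw [Ne, funext_iff, not_forall] at hxy
  obtain ⟨i, hi⟩ := hxy
  refine ⟨_, ⟨chi (Pi.single i 1), Algebra.subset_adjoin ⟨Pi.single i 1, rfl⟩, rfl⟩, ?_⟩
  have key : ∀ z : Torus d, chi (Pi.single i 1) z = fourier 1 (z i) := fun z => by
    rw [chi_apply, Finset.prod_eq_single i]
    · simp
    · intro j _ hj
      simp [Pi.single_eq_of_ne hj]
    · simp
  change chi (Pi.single i 1) x ≠ chi (Pi.single i 1) y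
  rw [key, key, fourier_one, fourier_one]
  exact fun h => hi (AddCircle.injective_toCircle Real.two_pi_pos.ne' (Circle.ext h))

/-- Stone–Weierstrass. -/
lemma span_chi_closure_eq_top (d : ℕ) :
    (Submodule.span ℂ (Set.range (chi (d := d)))).topologicalClosure = ⊤ := by
  rw [← trigPoly_coe]
  exact congr_arg (Subalgebra.toSubmodule <| StarSubalgebra.toSubalgebra ·)
    (ContinuousMap.starSubalgebra_topologicalClosure_eq_top_of_separatesPoints _
      (trigPoly_separatesPoints d))

lemma integrable_torus {d : ℕ} {E : Type*} [NormedAddCommGroup E]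
    (μ : Measure (Torus d)) [IsFiniteMeasure μ] {f : Torus d → E} (hf : Continuous f) :
    Integrable f μ :=
  hf.integrable_of_hasCompactSupport (HasCompactSupport.of_compactSpace f)

/-- A continuous function all of whose Fourier coefficients vanish is zero. -/
lemma eq_zero_of_integral_chi {d : ℕ} (f : C(Torus d, ℂ))
    (h : ∀ ξ : Fin d → ℤ, ∫ x, f x * conj (chi ξ x) = 0) : f = 0 := by
  -- The functional g ↦ ∫ f g is continuous and kills all characters, hence kills the closure of
  -- their span.
  have key : ∀ g : C(Torus d, ℂ), ∫ x, f x * g x = 0 := by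
    intro g
    have hg : g ∈ (Submodule.span ℂ (Set.range (chi (d := d)))).topologicalClosure := by
      rw [span_chi_closure_eq_top]; trivial
    have hcont : Continuous fun g : C(Torus d, ℂ) => ∫ x, f x * g x := by
      refine LipschitzWith.continuous (K := ⟨‖f‖ * volume.real (Set.univ : Set (Torus d)),
        by positivity⟩) (LipschitzWith.of_dist_le_mul fun g g' => ?_)
      rw [dist_eq_norm, dist_eq_norm, ← integral_sub (integrable_torus _ (by fun_prop))
        (integrable_torus _ (by fun_prop))]
      refine (norm_integral_le_of_norm_le_const (C := ‖f‖ * ‖g - g'‖)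
        (ae_of_all _ fun x => ?_)).trans (le_of_eq ?_)
      · rw [← mul_sub, norm_mul]
        exact mul_le_mul (f.norm_coe_le_norm x) ((g - g').norm_coe_le_norm x) (norm_nonneg _)
          (norm_nonneg _)
      · exact mul_right_comm _ _ _
    have hclosed : IsClosed {g : C(Torus d, ℂ) | ∫ x, f x * g x = 0} :=
      isClosed_singleton.preimage hcont
    refine closure_minimal ?_ hclosed hg
    intro p hp
    refine Submodule.span_induction ?_ ?_ ?_ ?_ hp
    · rintro _ ⟨ξ, rfl⟩
      have := h (-ξ)
      simpa [chi_neg_index] using this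
    · simp
    · intro a b _ _ ha hb
      simp only [Set.mem_ofPred_eq, ContinuousMap.add_apply, mul_add] at *
      rw [integral_add (integrable_torus _ (by fun_prop)) (integrable_torus _ (by fun_prop)), ha, hb,
        add_zero]
    · intro c a _ ha
      simp only [Set.mem_ofPred_eq, ContinuousMap.smul_apply, smul_eq_mul, mul_left_comm] at *
      rw [integral_const_mul, ha, mul_zero]
  -- Testing against the conjugate of f gives ∫ |f|² = 0.
  have h2 := key (star f)
  have h3 : ∫ x, ‖f x‖ ^ 2 = 0 := by
    have : ∀ x, f x * (star f) x = ((‖f x‖ ^ 2 : ℝ) : ℂ) := fun x => by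
      simp [Complex.mul_conj, Complex.normSq_eq_norm_sq]
    simp only [this] at h2
    rw [integral_complex_ofReal] at h2
    exact_mod_cast h2
  rw [integral_eq_zero_iff_of_nonneg (fun x => by positivity)
    (integrable_torus _ (by fun_prop))] at h3
  have h4 := (Continuous.ae_eq_iff_eq (volume : Measure (Torus d)) (by fun_prop)
    (continuous_const (y := (0 : ℝ)))).mp h3
  ext x
  simpa using congr_fun h4 x

/-! ### Fourier series and convolution with probability measures -/

lemma coeff_eq {d : ℕ} (f : Torus d → ℝ) (ξ : Fin d → ℤ) :
    coeff f ξ = (nrm d : ℂ) * ∫ x, (f x : ℂ) * conj (chi ξ x) := by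
  rw [coeff, ← integral_const_mul]
  congr 1
  ext x
  simp only [e_eq, map_mul, Complex.conj_ofReal]
  ring

/-- A continuous function with summable Fourier coefficients is the sum of its Fourier series. -/
lemma hasSum_of_summable_coeff {d : ℕ} {f : Torus d → ℝ} (hf : Continuous f)
    (hs : Summable fun ξ => ‖coeff f ξ‖) (x : Torus d) :
    HasSum (fun ξ => coeff f ξ * e ξ x) (f x : ℂ) := by
  have hsC : Summable fun ξ : Fin d → ℤ => (coeff f ξ * nrm d) • chi ξ := by
    refine Summable.of_norm_bounded (hs.mul_right (nrm d)) fun ξ => ?_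
    rw [norm_smul, norm_mul, Complex.norm_real, Real.norm_of_nonneg (nrm_pos d).le]
    refine mul_le_of_le_one_right (by have := nrm_pos d; positivity) ?_
    exact (ContinuousMap.norm_le _ zero_le_one).mpr fun y => (norm_chi ξ y).le
  set g : C(Torus d, ℂ) := ∑' ξ : Fin d → ℤ, (coeff f ξ * nrm d) • chi ξ with hg
  have hgx : ∀ y, HasSum (fun ξ => coeff f ξ * e ξ y) (g y) := fun y => by
    have := hsC.hasSum.map (ContinuousMap.evalCLM ℂ y) (ContinuousMap.evalCLM ℂ y).continuous
    convert! this using 2 with ξ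
    simp [e_eq, mul_assoc]
  -- By orthogonality the sum g of the series has the same Fourier coefficients as f; uniqueness
  -- then identifies the two.
  have hzero : (⟨fun y => (f y : ℂ), by fun_prop⟩ : C(Torus d, ℂ)) - g = 0 := by
    refine eq_zero_of_integral_chi _ fun ζ => ?_
    have h1 : HasSum (fun ξ : Fin d → ℤ => ∫ y, coeff f ξ * e ξ y * conj (chi ζ y))
        (∫ y, g y * conj (chi ζ y)) := by
      have h := hasSum_integral_of_summable_integral_norm (μ := (volume : Measure (Torus d)))
        (F := fun (ξ : Fin d → ℤ) y => coeff f ξ * e ξ y * conj (chi ζ y)) ?_ ?_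
      · have hy : ∀ y, ∑' ξ : Fin d → ℤ, coeff f ξ * e ξ y * conj (chi ζ y)
            = g y * conj (chi ζ y) := fun y => by rw [tsum_mul_right, (hgx y).tsum_eq]
        simpa only [hy] using h
      · intro ξ
        simp only [e_eq]
        exact integrable_torus _ (by fun_prop)
      · simp only [norm_mul, norm_e, RCLike.norm_conj, norm_chi, mul_one, integral_const]
        exact (hs.mul_right _).const_smul _
    have h2 : ∀ ξ : Fin d → ℤ, ∫ y, coeff f ξ * e ξ y * conj (chi ζ y)
        = if ξ = ζ then ∫ y, (f y : ℂ) * conj (chi ζ y) else 0 := fun ξ => by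
      have : ∀ y, coeff f ξ * e ξ y * conj (chi ζ y)
          = (coeff f ξ * nrm d) * chi (ξ - ζ) y := fun y => by
        rw [sub_eq_add_neg, chi_add_index, chi_neg_index, e_eq]; ring
      simp only [this]
      rw [integral_const_mul, integral_chi]
      by_cases h : ξ = ζ
      · subst h
        rw [if_pos (sub_self _), if_pos rfl, coeff_eq]
        have := congr_arg (fun r : ℝ => (r : ℂ)) (nrm_sq d)
        push_cast at this ⊢
        linear_combination (∫ y, (f y : ℂ) * conj (chi ξ y)) * this
      · rw [if_neg (sub_ne_zero.mpr h), if_neg h, mul_zero]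
    simp only [h2] at h1
    have h3 := h1.unique (hasSum_ite_eq ζ _)
    simp only [ContinuousMap.sub_apply, ContinuousMap.coe_mk, sub_mul]
    rw [integral_sub (integrable_torus _ (by fun_prop)) (integrable_torus _ (by fun_prop)), h3,
      sub_self]
  have : (f x : ℂ) = g x := by
    have := congr_arg (fun k : C(Torus d, ℂ) => k x) hzero
    simpa [sub_eq_zero] using this
  rw [this]
  exact hgx x

lemma norm_coeff_le {d : ℕ} (f : C(Torus d, ℝ)) (ξ : Fin d → ℤ) :
    ‖coeff f ξ‖ ≤ ‖f‖ * nrm d * volume.real (Set.univ : Set (Torus d)) := by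
  refine norm_integral_le_of_norm_le_const (ae_of_all _ fun x => ?_)
  rw [norm_mul, RCLike.norm_conj, norm_e, Complex.norm_real]
  exact mul_le_mul_of_nonneg_right (f.norm_coe_le_norm x) (nrm_pos d).le

/-- Dominated convergence with a constant majorant; it is the source of all continuity of averages
below. -/
lemma continuous_average {d : ℕ} {Ω : Type*} [TopologicalSpace Ω] [MeasurableSpace Ω]
    [OpensMeasurableSpace Ω] {μ : Measure Ω} [IsFiniteMeasure μ] {X : Type*} [TopologicalSpace X]
    [FirstCountableTopology X] {f : X → Torus d → ℝ} (hf : Continuous fun p : X × Torus d => f p.1 p.2)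
    {C : ℝ} (hC : ∀ p x, |f p x| ≤ C) {s : X → Ω → Torus d}
    (hs : Continuous fun p : X × Ω => s p.1 p.2) :
    Continuous fun p => ∫ ω, f p (s p ω) ∂μ := by
  refine continuous_of_dominated (bound := fun _ => C) (fun p => ?_)
    (fun p => ae_of_all _ fun ω => hC p _) (integrable_const _) (ae_of_all _ fun ω => ?_)
  · have h1 : Continuous (f p) := hf.comp (Continuous.prodMk_right p)
    have h2 : Continuous (s p) := hs.comp (Continuous.prodMk_right p)
    exact h1.comp_aestronglyMeasurable h2.measurable.aestronglyMeasurable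
  · exact hf.comp (continuous_id.prodMk (hs.comp (Continuous.prodMk_left ω)))

/-- Convolution with a probability measure multiplies the Fourier coefficients. -/
lemma coeff_conv {d : ℕ} (ν : Measure (Torus d)) [IsFiniteMeasure ν] {f : Torus d → ℝ}
    (hf : Continuous f) (ξ : Fin d → ℤ) :
    coeff (fun x => ∫ h, f (x - h) ∂ν) ξ = (∫ h, conj (chi ξ h) ∂ν) * coeff f ξ := by
  rw [coeff_eq, coeff_eq]
  have h1 : ∀ x : Torus d, ((∫ h, f (x - h) ∂ν : ℝ) : ℂ) * conj (chi ξ x)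
      = ∫ h, (f (x - h) : ℂ) * conj (chi ξ x) ∂ν := fun x => by
    rw [integral_mul_const, integral_complex_ofReal]
  simp only [h1]
  -- Fubini, then translation invariance of Lebesgue measure in the inner integral.
  rw [integral_integral_swap]
  · have h2 : ∀ h : Torus d, ∫ x, (f (x - h) : ℂ) * conj (chi ξ x)
        = conj (chi ξ h) * ∫ x, (f x : ℂ) * conj (chi ξ x) := fun h => by
      have h3 : ∀ x, (f (x - h) : ℂ) * conj (chi ξ x)
          = (fun y => (f y : ℂ) * conj (chi ξ (y + h))) (x - h) := fun x => by simp
      simp only [h3]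
      rw [integral_sub_right_eq_self (fun y => (f y : ℂ) * conj (chi ξ (y + h))),
        ← integral_const_mul]
      congr 1
      ext y
      rw [chi_add, map_mul]
      ring
    simp only [h2]
    rw [integral_mul_const]
    ring
  · refine Continuous.integrable_of_hasCompactSupport ?_ (HasCompactSupport.of_compactSpace _)
    simp only [Function.uncurry_def]
    fun_prop

/-- Convolution with a measure whose Fourier coefficients are summable is a Fourier multiplier. -/
lemma hasSum_conv {d : ℕ} (ν : Measure (Torus d)) [IsFiniteMeasure ν] {f : Torus d → ℝ}
    (hf : Continuous f) (m : (Fin d → ℤ) → ℝ) (hm : ∀ ξ, ∫ h, chi ξ h ∂ν = (m ξ : ℂ))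
    (hs : Summable fun ξ => |m ξ|) (x : Torus d) :
    HasSum (fun ξ => (m ξ : ℂ) * coeff f ξ * e ξ x) ((∫ h, f (x - h) ∂ν : ℝ) : ℂ) := by
  have hc : ∀ ξ, coeff (fun x => ∫ h, f (x - h) ∂ν) ξ = (m ξ : ℂ) * coeff f ξ := fun ξ => by
    -- The multiplier is the conjugate of `m ξ`, which is real.
    rw [coeff_conv ν hf, integral_conj, hm, Complex.conj_ofReal]
  simp only [← hc]
  refine hasSum_of_summable_coeff ?_ ?_ x
  · exact continuous_average (f := fun _ => f) (by fun_prop)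
      (fun _ y => (⟨f, hf⟩ : C(Torus d, ℝ)).norm_coe_le_norm y) (by fun_prop)
  · simp only [hc, norm_mul, Complex.norm_real, Real.norm_eq_abs]
    exact Summable.of_nonneg_of_le (fun _ => by positivity)
      (fun ξ => mul_le_mul_of_nonneg_left (norm_coeff_le ⟨f, hf⟩ ξ) (abs_nonneg _))
      (hs.mul_right _)

/-! ### Summation over frequencies -/

/-- Every finite set of frequencies lies in a box, over which the sum of products factors into
one-dimensional sums. -/
lemma summable_prod_pi {d : ℕ} {g : ℤ → ℝ} (hg : ∀ n, 0 ≤ g n) (hs : Summable g) :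
    Summable fun ξ : Fin d → ℤ => ∏ r, g (ξ r) := by
  classical
  refine summable_of_sum_le (c := (∑' n, g n) ^ d)
    (fun ξ => Finset.prod_nonneg fun r _ => hg _) fun u => ?_
  have hsub : u ⊆ Fintype.piFinset fun r => u.image fun ξ => ξ r := fun ξ hξ =>
    Fintype.mem_piFinset.mpr fun r => Finset.mem_image_of_mem _ hξ
  refine (Finset.sum_le_sum_of_subset_of_nonneg hsub
    fun ξ _ _ => Finset.prod_nonneg fun r _ => hg _).trans ?_
  rw [← Finset.prod_univ_sum (fun r => u.image fun ξ => ξ r) fun _ n => g n]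
  refine (Finset.prod_le_prod (fun r _ => Finset.sum_nonneg fun n _ => hg n)
    fun r _ => hs.sum_le_tsum _ fun n _ => hg n).trans ?_
  simp

lemma freqSq_nonneg {d : ℕ} (ξ : Fin d → ℤ) : 0 ≤ freqSq ξ :=
  Finset.sum_nonneg fun _ _ => sq_nonneg _

lemma summable_exp_freqSq {d : ℕ} {t : ℝ} (ht : 0 < t) :
    Summable fun ξ : Fin d → ℤ => Real.exp (-t * freqSq ξ) := by
  have h1 : Summable fun n : ℤ => Real.exp (-t * (n : ℝ) ^ 2) := by
    refine Summable.of_norm_bounded_eventually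
      ((Real.summable_one_div_int_pow (p := 2)).mpr one_lt_two |>.mul_left t⁻¹) ?_
    have : ∀ᶠ n : ℤ in cofinite, n ≠ 0 := (Set.finite_singleton (0 : ℤ)).compl_mem_cofinite
    filter_upwards [this] with n hn
    have hn' : (0 : ℝ) < (n : ℝ) ^ 2 := by positivity
    rw [Real.norm_of_nonneg (Real.exp_pos _).le, neg_mul, Real.exp_neg, one_div, ← mul_inv]
    exact inv_anti₀ (by positivity) ((by linarith [Real.add_one_le_exp (t * (n : ℝ) ^ 2)]))
  refine (summable_prod_pi (fun n => (Real.exp_pos _).le) h1).congr fun ξ => ?_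
  rw [← Real.exp_sum, freqSq, Finset.mul_sum]

/-- The exponent is distributed evenly over the coordinates: the weight is at most the product of
the (1 + ξ_r²)^(-s/d), each summable over ℤ because 2s/d > 1. Dimension zero is separate because of
the division by d. -/
lemma summable_sobolev_weight {d : ℕ} {s : ℝ} (hs : (d : ℝ) / 2 < s) :
    Summable fun ξ : Fin d → ℤ => (1 + freqSq ξ) ^ (-s) := by
  rcases Nat.eq_zero_or_pos d with rfl | hd
  · exact (hasSum_fintype _).summable
  have hd' : (0 : ℝ) < d := by exact_mod_cast hd
  have hs0 : 0 < s := lt_trans (by positivity) hs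
  have hsd : 1 < 2 * (s / d) := by
    rw [← mul_div_assoc, lt_div_iff₀ hd']
    linarith
  have h1 : Summable fun n : ℤ => (1 + (n : ℝ) ^ 2) ^ (-(s / d)) := by
    refine Summable.of_norm_bounded_eventually (Real.summable_abs_int_rpow hsd) ?_
    have : ∀ᶠ n : ℤ in cofinite, n ≠ 0 := (Set.finite_singleton (0 : ℤ)).compl_mem_cofinite
    filter_upwards [this] with n hn
    have hn' : (0 : ℝ) < |(n : ℝ)| := by positivity
    rw [Real.norm_of_nonneg (by positivity), ← mul_neg,
      Real.rpow_mul (abs_nonneg _), Real.rpow_two, sq_abs]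
    exact Real.rpow_le_rpow_of_nonpos (by positivity) (by linarith) (by
      have : 0 < s / d := by positivity
      linarith)
  refine Summable.of_nonneg_of_le (fun ξ => ?_) (fun ξ => ?_)
    (summable_prod_pi (d := d) (fun n => by positivity) h1)
  · have := freqSq_nonneg ξ
    positivity
  · have hq := freqSq_nonneg ξ
    have h2 : (1 + freqSq ξ) ^ (-s) = ∏ _r : Fin d, (1 + freqSq ξ) ^ (-(s / d)) := by
      rw [Finset.prod_const, Finset.card_univ, Fintype.card_fin, ← Real.rpow_natCast,
        ← Real.rpow_mul (by positivity)]
      congr 1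
      field_simp
    rw [h2]
    refine Finset.prod_le_prod (fun r _ => by positivity) fun r _ => ?_
    refine Real.rpow_le_rpow_of_nonpos (by positivity) ?_ (by
      have : 0 < s / d := by positivity
      linarith)
    gcongr
    exact Finset.single_le_sum (f := fun r => (ξ r : ℝ) ^ 2) (fun _ _ => sq_nonneg _)
      (Finset.mem_univ r)

/-! ### The Fejér kernel as a probability measure -/

/-- The density of the one-dimensional Fejér kernel. -/
noncomputable def fejerDensity (N : ℕ) (x : AddCircle (2 * π)) : NNReal :=
  ⟨((N : ℝ) + 1)⁻¹ * ‖∑ k ∈ Finset.range (N + 1), fourier (k : ℤ) x‖ ^ 2, by positivity⟩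

lemma coe_fejerDensity (N : ℕ) (x : AddCircle (2 * π)) : (fejerDensity N x : ℝ)
    = ((N : ℝ) + 1)⁻¹ * ‖∑ k ∈ Finset.range (N + 1), fourier (k : ℤ) x‖ ^ 2 := rfl

lemma continuous_fejerDensity (N : ℕ) : Continuous (fejerDensity N) := by
  refine Continuous.subtype_mk ?_ _
  fun_prop

/-- The one-dimensional Fejér kernel as a measure. -/
noncomputable def fejerLaw1 (N : ℕ) : Measure (AddCircle (2 * π)) :=
  AddCircle.haarAddCircle.withDensity fun x => (fejerDensity N x : ℝ≥0∞)

/-- Counts the pairs (j, k) in [0, N]² with k = j + n, the source of the triangular Fejér weight. -/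
lemma card_filter_shift (N : ℕ) (n : ℤ) :
    ((Finset.range (N + 1)).filter fun j : ℕ => 0 ≤ (j : ℤ) + n ∧ (j : ℤ) + n ≤ N).card
      = N + 1 - n.natAbs := by
  rcases le_total 0 n with h | h
  · have : (Finset.range (N + 1)).filter (fun j : ℕ => 0 ≤ (j : ℤ) + n ∧ (j : ℤ) + n ≤ N)
        = Finset.range (N + 1 - n.natAbs) := by
      ext j
      simp only [Finset.mem_filter, Finset.mem_range]
      omega
    rw [this, Finset.card_range]
  · have : (Finset.range (N + 1)).filter (fun j : ℕ => 0 ≤ (j : ℤ) + n ∧ (j : ℤ) + n ≤ N)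
        = Finset.Ico n.natAbs (N + 1) := by
      ext j
      simp only [Finset.mem_filter, Finset.mem_range, Finset.mem_Ico]
      omega
    rw [this, Nat.card_Ico]

/-- The one-dimensional Fejér weight. -/
noncomputable def fejerWeight (N : ℕ) (n : ℤ) : ℝ := max (1 - |(n : ℝ)| / ((N : ℝ) + 1)) 0

lemma fejerWeight_eq (N : ℕ) (n : ℤ) :
    fejerWeight N n = ((N : ℝ) + 1)⁻¹ * ((N + 1 - n.natAbs : ℕ) : ℝ) := by
  have hN : (0 : ℝ) < (N : ℝ) + 1 := by positivity
  have habs : |(n : ℝ)| = (n.natAbs : ℝ) := by simp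
  rw [fejerWeight, habs]
  rcases le_total n.natAbs (N + 1) with h | h
  · rw [Nat.cast_sub h, max_eq_left]
    · push_cast
      field_simp
    · rw [sub_nonneg, div_le_one hN]
      exact_mod_cast h
  · rw [Nat.sub_eq_zero_of_le h, max_eq_right]
    · simp
    · rw [sub_nonpos, one_le_div hN]
      exact_mod_cast h

/-- Expanding the square in the density gives a double sum over (j, k) of characters of frequency j
- k + n; orthogonality keeps the pairs with k = j + n. -/
lemma integral_fejerLaw1 (N : ℕ) (n : ℤ) :
    ∫ x, fourier n x ∂(fejerLaw1 N) = (fejerWeight N n : ℂ) := by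
  rw [fejerLaw1, integral_withDensity_eq_integral_smul (continuous_fejerDensity N).measurable]
  have h1 : ∀ x : AddCircle (2 * π), fejerDensity N x • (fourier n x : ℂ)
      = ((N : ℂ) + 1)⁻¹ * ∑ j ∈ Finset.range (N + 1), ∑ k ∈ Finset.range (N + 1),
          fourier ((j : ℤ) - k + n) x := fun x => by
    have h2 : ((‖∑ k ∈ Finset.range (N + 1), fourier (k : ℤ) x‖ ^ 2 : ℝ) : ℂ)
        = ∑ j ∈ Finset.range (N + 1), ∑ k ∈ Finset.range (N + 1), fourier ((j : ℤ) - k) x := by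
      rw [← Complex.normSq_eq_norm_sq, ← Complex.mul_conj, map_sum, Finset.sum_mul_sum]
      simp only [sub_eq_add_neg, fourier_add, fourier_neg]
    rw [NNReal.smul_def, Complex.real_smul, coe_fejerDensity, Complex.ofReal_mul, h2, mul_assoc,
      Finset.sum_mul]
    simp only [Finset.sum_mul, fourier_add]
    push_cast
    rfl
  simp only [h1]
  have hint : ∀ m : ℤ, Integrable (fun x : AddCircle (2 * π) => (fourier m x : ℂ))
      AddCircle.haarAddCircle := fun m =>
    (fourier m).continuous.integrable_of_hasCompactSupport (HasCompactSupport.of_compactSpace _)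
  rw [integral_const_mul, integral_finsetSum _ fun j _ => integrable_finsetSum _ fun k _ => hint _]
  have h3 : ∀ j : ℕ, ∫ x : AddCircle (2 * π), ∑ k ∈ Finset.range (N + 1),
        (fourier ((j : ℤ) - k + n) x : ℂ) ∂AddCircle.haarAddCircle
      = if 0 ≤ (j : ℤ) + n ∧ (j : ℤ) + n ≤ N then 1 else 0 := fun j => by
    rw [integral_finsetSum _ fun k _ => hint _]
    simp only [integral_haar_fourier]
    split_ifs with h
    · rw [Finset.sum_eq_single ((j : ℤ) + n).toNat]
      · rw [if_pos (by omega)]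
      · intro k _ hk
        rw [if_neg (by omega)]
      · intro hk
        rw [Finset.mem_range] at hk
        omega
    · refine Finset.sum_eq_zero fun k hk => ?_
      rw [Finset.mem_range] at hk
      rw [if_neg (by omega)]
  simp only [h3]
  rw [Finset.sum_boole, card_filter_shift, fejerWeight_eq]
  push_cast
  rfl

/-- The total mass is the Fourier coefficient at frequency zero, where the Fejér weight is 1. -/
instance isProbabilityMeasure_fejerLaw1 (N : ℕ) : IsProbabilityMeasure (fejerLaw1 N) := by
  have hfin : IsFiniteMeasure (fejerLaw1 N) := by
    have h := isFiniteMeasure_withDensity_ofReal (μ := AddCircle.haarAddCircle)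
      (f := fun x => (fejerDensity N x : ℝ))
      ((NNReal.continuous_coe.comp (continuous_fejerDensity N)).integrable_of_hasCompactSupport
        (HasCompactSupport.of_compactSpace _)).2
    simpa [fejerLaw1] using h
  have h := integral_fejerLaw1 N 0
  have h0 : fejerWeight N 0 = 1 := by simp [fejerWeight]
  rw [h0] at h
  simp only [fourier_zero, integral_const, Complex.real_smul, mul_one] at h
  have h' : (fejerLaw1 N).real Set.univ = 1 := by exact_mod_cast h
  rw [Measure.real, ENNReal.toReal_eq_one_iff] at h'
  exact ⟨h'⟩

/-- The tensor-product Fejér kernel as a measure on the torus. -/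
noncomputable def fejerLaw (d N : ℕ) : Measure (Torus d) := Measure.pi fun _ => fejerLaw1 N

instance isProbabilityMeasure_fejerLaw (d N : ℕ) : IsProbabilityMeasure (fejerLaw d N) := by
  unfold fejerLaw; infer_instance

lemma integral_fejerLaw {d : ℕ} (N : ℕ) (ξ : Fin d → ℤ) :
    ∫ h, chi ξ h ∂(fejerLaw d N) = (fejerSymbol N ξ : ℂ) := by
  simp only [chi_apply, fejerLaw]
  rw [integral_fintype_prod_eq_prod (fun r (x : AddCircle (2 * π)) => (fourier (ξ r) x : ℂ))]
  simp only [integral_fejerLaw1, fejerSymbol, fejerWeight]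
  push_cast
  rfl

lemma fejerSymbol_eq_zero {d N : ℕ} {ξ : Fin d → ℤ} (h : ξ ∉ freqBox d N) :
    fejerSymbol N ξ = 0 := by
  simp only [freqBox, Fintype.mem_piFinset, Finset.mem_Icc, not_forall] at h
  obtain ⟨r, hr⟩ := h
  refine Finset.prod_eq_zero (Finset.mem_univ r) (max_eq_right ?_)
  have hN : (0 : ℝ) < (N : ℝ) + 1 := by positivity
  rw [sub_nonpos, one_le_div hN]
  have : (N : ℤ) + 1 ≤ |ξ r| := by
    by_contra hc
    exact hr (abs_le.mp (by omega))
  exact_mod_cast this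

/-- The symbol vanishes outside the frequency box, so the finite sum defining the cutoff is already
the full multiplier series of the convolution. -/
lemma fejer_eq {d : ℕ} (N : ℕ) {f : Torus d → ℝ} (hf : Continuous f) (x : Torus d) :
    fejer N f x = ∫ h, f (x - h) ∂(fejerLaw d N) := by
  have hs : Summable fun ξ : Fin d → ℤ => |fejerSymbol N ξ| :=
    summable_of_ne_finset_zero (s := freqBox d N) fun ξ hξ => by
      rw [fejerSymbol_eq_zero hξ, abs_zero]
  have h := hasSum_conv (fejerLaw d N) hf (fejerSymbol N) (integral_fejerLaw N) hs x
  have h2 : HasSum (fun ξ => (fejerSymbol N ξ : ℂ) * coeff f ξ * e ξ x)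
      (∑ ξ ∈ freqBox d N, (fejerSymbol N ξ : ℂ) * coeff f ξ * e ξ x) :=
    hasSum_sum_of_ne_finset_zero fun ξ hξ => by rw [fejerSymbol_eq_zero hξ]; simp
  rw [fejer, h2.unique h, Complex.ofReal_re]

/-! ### The heat semigroup as an average over Gaussian shifts -/

/-- The standard Gaussian measure on `ℝᵈ`. -/
noncomputable def gauss (d : ℕ) : Measure (Fin d → ℝ) :=
  Measure.pi fun _ => ProbabilityTheory.gaussianReal 0 1

instance isProbabilityMeasure_gauss (d : ℕ) : IsProbabilityMeasure (gauss d) := by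
  unfold gauss; infer_instance

/-- The class of `√(2t) z` in the torus. -/
noncomputable def wrap {d : ℕ} (t : ℝ) (z : Fin d → ℝ) : Torus d :=
  fun r => ((√(2 * t) * z r : ℝ) : AddCircle (2 * π))

lemma continuous_wrap (d : ℕ) : Continuous fun p : ℝ × (Fin d → ℝ) => wrap p.1 p.2 :=
  continuous_pi fun r => (AddCircle.continuous_mk' _).comp (by fun_prop)

lemma continuous_wrap_right {d : ℕ} (t : ℝ) : Continuous (wrap (d := d) t) :=
  (continuous_wrap d).comp (Continuous.prodMk_right t)

lemma wrap_zero {d : ℕ} (z : Fin d → ℝ) : wrap 0 z = 0 := by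
  ext r; simp [wrap]

/-- In each coordinate this is the Gaussian characteristic function at n√(2t), that is exp(-tn²). -/
lemma integral_chi_wrap {d : ℕ} {t : ℝ} (ht : 0 ≤ t) (ξ : Fin d → ℤ) :
    ∫ z, chi ξ (wrap t z) ∂(gauss d) = (Real.exp (-t * freqSq ξ) : ℂ) := by
  simp only [chi_apply, wrap, gauss]
  rw [integral_fintype_prod_eq_prod
    (fun r (z : ℝ) => (fourier (ξ r) ((√(2 * t) * z : ℝ) : AddCircle (2 * π)) : ℂ))]
  have h : ∀ n : ℤ, ∫ z : ℝ, (fourier n ((√(2 * t) * z : ℝ) : AddCircle (2 * π)) : ℂ)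
      ∂(ProbabilityTheory.gaussianReal 0 1) = (Real.exp (-t * (n : ℝ) ^ 2) : ℂ) := fun n => by
    have h1 := ProbabilityTheory.charFun_gaussianReal (μ := 0) (v := 1) (n * √(2 * t))
    rw [charFun_apply_real] at h1
    have h2 : ∀ z : ℝ, (fourier n ((√(2 * t) * z : ℝ) : AddCircle (2 * π)) : ℂ)
        = Complex.exp (((n * √(2 * t) : ℝ) : ℂ) * z * Complex.I) := fun z => by
      rw [fourier_coe_apply]
      congr 1
      have hp : (π : ℂ) ≠ 0 := by exact_mod_cast Real.pi_ne_zero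
      push_cast
      field_simp
    simp only [h2]
    rw [h1, Complex.ofReal_exp]
    congr 1
    have h3 : ((√(2 * t) : ℝ) : ℂ) ^ 2 = 2 * t := by
      rw [← Complex.ofReal_pow, Real.sq_sqrt (by linarith)]
      push_cast
      rfl
    push_cast
    linear_combination (-(n : ℂ) ^ 2 / 2) * h3
  simp only [h]
  rw [freqSq, Finset.mul_sum, Real.exp_sum]
  push_cast
  rfl

/-- The average of `f` over the shifts by `h + √(2t) z`, with `h ∼ ν` and `z` standard Gaussian. -/
noncomputable def heatAvg {d : ℕ} (ν : Measure (Torus d)) (t : ℝ) (f : Torus d → ℝ)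
    (x : Torus d) : ℝ :=
  ∫ p, f (x - (p.1 + wrap t p.2)) ∂(ν.prod (gauss d))

lemma continuous_shift (d : ℕ) :
    Continuous fun p : ℝ × (Torus d × (Fin d → ℝ)) => p.2.1 + wrap p.1 p.2.2 :=
  (continuous_fst.comp continuous_snd).add
    ((continuous_wrap d).comp (by fun_prop : Continuous fun p : ℝ × (Torus d × (Fin d → ℝ)) =>
      (p.1, p.2.2)))

lemma continuous_shift_right {d : ℕ} (t : ℝ) :
    Continuous fun p : Torus d × (Fin d → ℝ) => p.1 + wrap t p.2 :=
  (continuous_shift d).comp (Continuous.prodMk_right t)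

lemma exists_bound_torus {d : ℕ} {f : Torus d → ℝ} (hf : Continuous f) : ∃ C, ∀ x, |f x| ≤ C :=
  ⟨_, fun x => (⟨f, hf⟩ : C(Torus d, ℝ)).norm_coe_le_norm x⟩

lemma integrable_shift {d : ℕ} (ν : Measure (Torus d)) [IsProbabilityMeasure ν] (t : ℝ)
    {f : Torus d → ℝ} (hf : Continuous f) (x : Torus d) :
    Integrable (fun p => f (x - (p.1 + wrap t p.2))) (ν.prod (gauss d)) := by
  obtain ⟨C, hC⟩ := exists_bound_torus hf
  refine Integrable.of_bound (C := C) ?_ (ae_of_all _ fun p => hC _)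
  exact (hf.comp (continuous_const.sub (continuous_shift_right t))).aestronglyMeasurable

lemma heatAvg_dirac {d : ℕ} (t : ℝ) {f : Torus d → ℝ} (hf : Continuous f) (x : Torus d) :
    heatAvg (Measure.dirac 0) t f x = ∫ z, f (x - wrap t z) ∂(gauss d) := by
  rw [heatAvg, integral_prod _ (integrable_shift _ t hf x), integral_dirac]
  simp

/-- At t = 0 the Gaussian shift is trivial, which matches the separate clause of `heat`. For t > 0
the wrapped Gaussian has the heat symbol, and that symbol is summable. -/
lemma heat_eq {d : ℕ} {t : ℝ} (ht : 0 ≤ t) {f : Torus d → ℝ} (hf : Continuous f) (x : Torus d) :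
    heat t f x = heatAvg (Measure.dirac 0) t f x := by
  rw [heatAvg_dirac t hf]
  rcases ht.eq_or_lt with rfl | ht
  · simp [heat, wrap_zero]
  have hw : Measurable (wrap (d := d) t) := (continuous_wrap_right t).measurable
  have : IsProbabilityMeasure ((gauss d).map (wrap t)) :=
    Measure.isProbabilityMeasure_map hw.aemeasurable
  have h := hasSum_conv ((gauss d).map (wrap t)) hf (fun ξ => Real.exp (-t * freqSq ξ))
    (fun ξ => by
      rw [integral_map hw.aemeasurable (chi ξ).continuous.aestronglyMeasurable,
        integral_chi_wrap ht.le])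
    (by simpa only [Real.abs_exp] using summable_exp_freqSq ht) x
  have hm : AEStronglyMeasurable (fun y => f (x - y)) ((gauss d).map (wrap t)) :=
    (hf.comp (continuous_const.sub continuous_id)).aestronglyMeasurable
  rw [integral_map hw.aemeasurable hm] at h
  rw [heat, if_neg ht.ne', h.tsum_eq, Complex.ofReal_re]

lemma continuous_heatAvg {d : ℕ} (ν : Measure (Torus d)) [IsProbabilityMeasure ν]
    {X : Type*} [TopologicalSpace X] [FirstCountableTopology X] {f : X → Torus d → ℝ}
    (hf : Continuous fun p : X × Torus d => f p.1 p.2) {C : ℝ} (hC : ∀ p x, |f p x| ≤ C)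
    {s : X → ℝ} (hs : Continuous s) {x : X → Torus d} (hx : Continuous x) :
    Continuous fun p => heatAvg ν (s p) (f p) (x p) := by
  refine continuous_average (μ := ν.prod (gauss d)) hf hC
    (s := fun p ω => x p - (ω.1 + wrap (s p) ω.2)) ?_
  exact (hx.comp continuous_fst).sub
    ((continuous_shift d).comp ((hs.comp continuous_fst).prodMk continuous_snd))

lemma continuous_heatAvg_right {d : ℕ} (ν : Measure (Torus d)) [IsProbabilityMeasure ν] (t : ℝ)
    {f : Torus d → ℝ} (hf : Continuous f) : Continuous (heatAvg ν t f) := by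
  obtain ⟨C, hC⟩ := exists_bound_torus hf
  exact continuous_heatAvg ν (X := Torus d) (f := fun _ => f) (by fun_prop) (fun _ => hC)
    continuous_const continuous_id

lemma heatAvg_eq_integral {d : ℕ} (ν : Measure (Torus d)) [IsProbabilityMeasure ν] (t : ℝ)
    {f : Torus d → ℝ} (hf : Continuous f) (x : Torus d) :
    heatAvg ν t f x = ∫ h, heatAvg (Measure.dirac 0) t f (x - h) ∂ν := by
  rw [heatAvg, integral_prod _ (integrable_shift _ t hf x)]
  simp only [heatAvg_dirac t hf, sub_sub]

/-- Two successive independent shifts amount to one shift by their sum. -/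
lemma truncHeat_eq {d : ℕ} (N : ℕ) {t : ℝ} (ht : 0 ≤ t) {f : Torus d → ℝ} (hf : Continuous f)
    (x : Torus d) : truncHeat N t f x = heatAvg (fejerLaw d N) t f x := by
  have h : heat t f = heatAvg (Measure.dirac 0) t f := funext fun y => heat_eq ht hf y
  rw [truncHeat, h, fejer_eq N (continuous_heatAvg_right _ t hf), heatAvg_eq_integral _ t hf]

/-! ### Piecewise linear interpolation by ReLU networks -/

/-- The ramp that grows with slope one on `[a, b]` and is constant outside. -/
noncomputable def ramp (a b y : ℝ) : ℝ := max (y - a) 0 - max (y - b) 0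

lemma ramp_mono {a b : ℝ} (hab : a ≤ b) : Monotone (ramp a b) := by
  intro y z hyz
  simp only [ramp]
  rcases max_cases (y - a) 0 with h1 | h1 <;> rcases max_cases (y - b) 0 with h2 | h2 <;>
  rcases max_cases (z - a) 0 with h3 | h3 <;> rcases max_cases (z - b) 0 with h4 | h4 <;> linarith

lemma ramp_of_le {a b y : ℝ} (hab : a ≤ b) (hy : y ≤ a) : ramp a b y = 0 := by
  rw [ramp, max_eq_right (by linarith), max_eq_right (by linarith), sub_zero]

lemma ramp_of_ge {a b y : ℝ} (hab : a ≤ b) (hy : b ≤ y) : ramp a b y = b - a := by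
  rw [ramp, max_eq_left (by linarith), max_eq_left (by linarith)]
  ring

lemma sum_ramp (y : ℕ → ℝ) (m : ℕ) (x : ℝ) :
    ∑ k ∈ Finset.range m, ramp (y k) (y (k + 1)) x = max (x - y 0) 0 - max (x - y m) 0 := by
  simp only [ramp]
  exact Finset.sum_range_sub' (fun k => max (x - y k) 0) m

/-- The network with one hidden layer realizing `c + ∑ σ_k ramp (y_k, y_{k+1})`. -/
noncomputable def rampNet (m : ℕ) (c : ℝ) (σ y : ℕ → ℝ) : ReLUNet 1 :=
  .hidden (m := m + m) (fun _ _ => 1)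
    (Fin.append (fun k : Fin m => -y k) fun k : Fin m => -y (k + 1))
    (.output (Fin.append (fun k : Fin m => σ k) fun k : Fin m => -σ k) c)

lemma rampNet_fn (m : ℕ) (c : ℝ) (σ y : ℕ → ℝ) (x : ℝ) :
    (rampNet m c σ y).fn x = c + ∑ k ∈ Finset.range m, σ k * ramp (y k) (y (k + 1)) x := by
  simp only [ReLUNet.fn, rampNet, ReLUNet.eval, dotProduct, Fin.sum_univ_add, Fin.append_left,
    Fin.append_right, Pi.add_apply, Matrix.mulVec, Finset.univ_unique, Finset.sum_singleton]
  rw [← Finset.sum_add_distrib, add_comm, Finset.sum_range fun k => σ k * ramp (y k) (y (k + 1)) x]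
  congr 1
  refine Finset.sum_congr rfl fun k _ => ?_
  simp only [ramp, one_mul, sub_eq_add_neg]
  ring

lemma rampNet_size (m : ℕ) (c : ℝ) (σ y : ℕ → ℝ) : (rampNet m c σ y).size = 6 * m + 1 := by
  simp only [rampNet, ReLUNet.size]
  ring

/-- Linear interpolation on an equidistant grid of `[-M, M]`. -/
lemma exists_approximates {M L η : ℝ} (hM : 0 < M) (hL : 0 < L) (hη : 0 < η) {F : ℝ → ℝ}
    (hF : F ∈ nonlinClass M L) :
    ∃ ρ : ReLUNet 1, Approximates M L η F ρ ∧ (ρ.size : ℝ) ≤ 25 * (1 + M * L * η⁻¹) := by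
  obtain ⟨hF0, hFL⟩ := hF
  have hpos : 0 < 2 * L * M / η := by positivity
  -- This makes the mesh w = M / n satisfy 2Lw ≤ η.
  set n : ℕ := ⌈2 * L * M / η⌉₊ with hn
  have hn0 : (0 : ℝ) < n := by exact_mod_cast Nat.ceil_pos.mpr hpos
  have hnη : 2 * L * (M / n) ≤ η := by
    have := Nat.le_ceil (2 * L * M / η)
    rw [← hn, div_le_iff₀ hη] at this
    rw [← mul_div_assoc, div_le_iff₀ hn0]
    linarith
  set w : ℝ := M / n with hw
  have hw0 : 0 < w := by positivity
  have hwn : w * n = M := by rw [hw]; field_simp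
  -- There are 2n cells, so that 0 is the node of index n and ρ(0) = F(0) = 0 comes from
  -- interpolation.
  set y : ℕ → ℝ := fun k => -M + k * w with hy
  have hstep : ∀ k, y (k + 1) - y k = w := fun k => by simp only [hy]; push_cast; ring
  have hmono : Monotone y := fun i j hij => by
    simp only [hy]
    gcongr
  have hy0 : y 0 = -M := by simp [hy]
  have hyn : y n = 0 := by simp only [hy]; linarith
  have hym : y (2 * n) = M := by simp only [hy]; push_cast; linarith
  have hmem : ∀ k ≤ 2 * n, y k ∈ Set.Icc (-M) M := fun k hk =>
    ⟨hy0 ▸ hmono (Nat.zero_le k), hym ▸ hmono hk⟩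
  set σ : ℕ → ℝ := fun k => (F (y (k + 1)) - F (y k)) / w with hσ
  have hσL : ∀ k ∈ Finset.range (2 * n), |σ k| ≤ L := fun k hk => by
    rw [Finset.mem_range] at hk
    have := hFL _ (hmem (k + 1) (by omega)) _ (hmem k (by omega))
    rw [hstep, abs_of_pos hw0] at this
    simp only [hσ]
    rwa [abs_div, abs_of_pos hw0, div_le_iff₀ hw0]
  set ρ := rampNet (2 * n) (F (-M)) σ y with hρ
  have hlip' : ∀ a ∈ Set.Icc (-M) M, ∀ b ∈ Set.Icc (-M) M, a ≤ b →
      |ρ.fn b - ρ.fn a| ≤ L * (b - a) := by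
    intro a ha b hb hab
    have h1 : ρ.fn b - ρ.fn a = ∑ k ∈ Finset.range (2 * n),
        σ k * (ramp (y k) (y (k + 1)) b - ramp (y k) (y (k + 1)) a) := by
      rw [hρ, rampNet_fn, rampNet_fn]
      simp only [mul_sub, Finset.sum_sub_distrib]
      ring
    rw [h1]
    refine (Finset.abs_sum_le_sum_abs _ _).trans ?_
    have h2 : ∀ k ∈ Finset.range (2 * n),
        |σ k * (ramp (y k) (y (k + 1)) b - ramp (y k) (y (k + 1)) a)|
          ≤ L * (ramp (y k) (y (k + 1)) b - ramp (y k) (y (k + 1)) a) := fun k hk => by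
      have h3 := sub_nonneg.mpr (ramp_mono (hmono (Nat.le_succ k)) hab)
      rw [abs_mul, abs_of_nonneg h3]
      exact mul_le_mul_of_nonneg_right (hσL k hk) h3
    -- The increments of the ramps are nonnegative and telescope to b - a, so bounded slopes give
    -- the Lipschitz bound.
    refine (Finset.sum_le_sum h2).trans (le_of_eq ?_)
    rw [← Finset.mul_sum, Finset.sum_sub_distrib, sum_ramp, sum_ramp, hy0, hym,
      max_eq_left (by linarith [hb.1]), max_eq_right (by linarith [hb.2]),
      max_eq_left (by linarith [ha.1]), max_eq_right (by linarith [ha.2])]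
    ring
  have hlip : ∀ a ∈ Set.Icc (-M) M, ∀ b ∈ Set.Icc (-M) M,
      |ρ.fn a - ρ.fn b| ≤ L * |a - b| := by
    intro a ha b hb
    rcases le_total a b with h | h
    · rw [abs_sub_comm, abs_sub_comm a b, abs_of_nonneg (sub_nonneg.mpr h)]
      exact hlip' a ha b hb h
    · rw [abs_of_nonneg (sub_nonneg.mpr h)]
      exact hlip' b hb a ha h
  have hnode : ∀ j ≤ 2 * n, ρ.fn (y j) = F (y j) := fun j hj => by
    rw [hρ, rampNet_fn, ← Finset.sum_range_add_sum_Ico _ hj]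
    have h1 : ∀ k ∈ Finset.range j, σ k * ramp (y k) (y (k + 1)) (y j)
        = F (y (k + 1)) - F (y k) := fun k hk => by
      rw [ramp_of_ge (hmono (Nat.le_succ k)) (hmono (Finset.mem_range.mp hk)), hstep]
      simp only [hσ]
      field_simp
    have h2 : ∀ k ∈ Finset.Ico j (2 * n), σ k * ramp (y k) (y (k + 1)) (y j) = 0 := fun k hk => by
      rw [ramp_of_le (hmono (Nat.le_succ k)) (hmono (Finset.mem_Ico.mp hk).1), mul_zero]
    rw [Finset.sum_congr rfl h1, Finset.sum_congr rfl h2, Finset.sum_range_sub fun k => F (y k),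
      hy0]
    simp
  refine ⟨ρ, ⟨fun x hx => ?_, ?_, hlip⟩, ?_⟩
  · set j : ℕ := ⌊(x + M) / w⌋₊ with hj
    have hx0 : 0 ≤ (x + M) / w := div_nonneg (by linarith [hx.1]) hw0.le
    have hj1 : y j ≤ x := by
      have := Nat.floor_le hx0
      rw [← hj, le_div_iff₀ hw0] at this
      simp only [hy]
      linarith
    have hj2 : x < y j + w := by
      have := Nat.lt_floor_add_one ((x + M) / w)
      rw [← hj, div_lt_iff₀ hw0] at this
      simp only [hy]
      linarith
    -- The index 2n itself occurs, at x = M.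
    have hjm : j ≤ 2 * n := by
      by_contra hc
      have := hmono (show 2 * n + 1 ≤ j by omega)
      have h3 := hstep (2 * n)
      linarith [hx.2]
    have h1 := hFL x hx _ (hmem j hjm)
    have h2 := hlip _ (hmem j hjm) x hx
    rw [hnode j hjm, abs_sub_comm (y j) x] at h2
    rw [abs_of_nonneg (sub_nonneg.mpr hj1)] at h1 h2
    -- F and ρ agree at the node to the left of x, and each moves by at most Lw from there.
    have h3 : L * (x - y j) ≤ L * w := by
      gcongr
      linarith
    calc |F x - ρ.fn x| ≤ |F x - F (y j)| + |F (y j) - ρ.fn x| := abs_sub_le _ _ _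
      _ ≤ η := by linarith
  · rw [← hyn, hnode n (by omega), hyn, hF0]
  -- The size is 12n + 1 with n < 2X + 1 and X = ML/η, hence below 24X + 13.
  · rw [hρ, rampNet_size]
    have h1 : (n : ℝ) < 2 * L * M / η + 1 := Nat.ceil_lt_add_one hpos.le
    have h2 : 2 * L * M / η = 2 * (M * L * η⁻¹) := by field_simp
    push_cast
    have h3 : 0 < M * L * η⁻¹ := by positivity
    linarith

/-! ### Estimates for averages -/

lemma abs_integral_le_of_forall {Ω : Type*} [MeasurableSpace Ω] (μ : Measure Ω)
    [IsProbabilityMeasure μ] {f : Ω → ℝ} {C : ℝ} (h : ∀ ω, |f ω| ≤ C) : |∫ ω, f ω ∂μ| ≤ C := by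
  have := norm_integral_le_of_norm_le_const (μ := μ) (f := f) (C := C) (ae_of_all _ h)
  simpa using this

lemma abs_intervalIntegral_le {f : ℝ → ℝ} {t D : ℝ} (ht : 0 ≤ t)
    (h : ∀ τ ∈ Set.Icc 0 t, |f τ| ≤ D) : |∫ τ in (0 : ℝ)..t, f τ| ≤ D * t := by
  have h1 : ∀ τ ∈ Set.uIoc 0 t, ‖f τ‖ ≤ D := fun τ hτ => by
    rw [Set.uIoc_of_le ht] at hτ
    exact h τ ⟨hτ.1.le, hτ.2⟩
  have h2 := intervalIntegral.norm_integral_le_of_norm_le_const h1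
  rwa [sub_zero, abs_of_nonneg ht] at h2

/-- Both averages use the same random shift, so a bound that is uniform in the shift survives. The
two base points allow translation moduli to be treated as comparisons. -/
lemma heatAvg_dist {d : ℕ} (ν : Measure (Torus d)) [IsProbabilityMeasure ν] (t : ℝ)
    {f g : Torus d → ℝ} (hf : Continuous f) (hg : Continuous g) (x y : Torus d) {D : ℝ}
    (h : ∀ s, |f (x - s) - g (y - s)| ≤ D) : |heatAvg ν t f x - heatAvg ν t g y| ≤ D := by
  rw [heatAvg, heatAvg, ← integral_sub (integrable_shift ν t hf x) (integrable_shift ν t hg y)]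
  exact abs_integral_le_of_forall _ fun _ => h _

lemma abs_heatAvg_le {d : ℕ} (ν : Measure (Torus d)) [IsProbabilityMeasure ν] (t : ℝ)
    {f : Torus d → ℝ} {C : ℝ} (h : ∀ x, |f x| ≤ C) (x : Torus d) :
    |heatAvg ν t f x| ≤ C :=
  abs_integral_le_of_forall _ fun _ => h _

/-- Averaging a function with translation modulus `ω` over additional shifts. -/
lemma heatAvg_sub_dirac {d : ℕ} (ν : Measure (Torus d)) [IsProbabilityMeasure ν] (t : ℝ)
    {f : Torus d → ℝ} (hf : Continuous f) {ω : Torus d → ℝ} (hω : Integrable ω ν)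
    (h : ∀ s x, |f (x - s) - f x| ≤ ω s) (x : Torus d) :
    |heatAvg ν t f x - heatAvg (Measure.dirac 0) t f x| ≤ ∫ s, ω s ∂ν := by
  have hc := continuous_heatAvg_right (Measure.dirac 0) t hf
  have h1 : heatAvg ν t f x - heatAvg (Measure.dirac 0) t f x
      = ∫ s, (heatAvg (Measure.dirac 0) t f (x - s) - heatAvg (Measure.dirac 0) t f x) ∂ν := by
    rw [integral_sub (integrable_torus ν (by fun_prop)) (integrable_const _),
      ← heatAvg_eq_integral ν t hf]
    simp
  rw [h1]
  refine norm_integral_le_of_norm_le (G := ℝ) hω (ae_of_all _ fun s => ?_)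
  refine heatAvg_dist _ t hf hf _ _ fun r => ?_
  have := h s (x - r)
  rwa [sub_right_comm] at this

/-! ### Regularity of the Duhamel integral -/

section Duhamel

variable {d : ℕ} {T C : ℝ} {g : ℝ → Torus d → ℝ}

lemma continuous_slice (hg : ContinuousOn (fun p : ℝ × Torus d => g p.1 p.2)
    (Set.Icc 0 T ×ˢ Set.univ)) {t : ℝ} (ht : t ∈ Set.Icc 0 T) : Continuous (g t) :=
  hg.comp_continuous (Continuous.prodMk_right t) fun _ => ⟨ht, trivial⟩

/-- Freezing the function in time outside [0, T] yields a globally continuous function, as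
continuity of parametric integrals demands. -/
lemma continuous_clamp (hT : 0 ≤ T) (hg : ContinuousOn (fun p : ℝ × Torus d => g p.1 p.2)
    (Set.Icc 0 T ×ˢ Set.univ)) :
    Continuous fun p : ℝ × Torus d => g (Set.projIcc 0 T hT p.1) p.2 :=
  hg.comp_continuous (f := fun p : ℝ × Torus d => ((Set.projIcc 0 T hT p.1 : ℝ), p.2))
    ((continuous_subtype_val.comp (continuous_projIcc.comp continuous_fst)).prodMk continuous_snd)
    fun p => ⟨(Set.projIcc 0 T hT p.1).2, trivial⟩

variable (ν : Measure (Torus d)) [IsProbabilityMeasure ν]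

lemma intervalIntegrable_heatAvg (hT : 0 ≤ T)
    (hg : ContinuousOn (fun p : ℝ × Torus d => g p.1 p.2) (Set.Icc 0 T ×ˢ Set.univ))
    (hC : ∀ t ∈ Set.Icc 0 T, ∀ x, |g t x| ≤ C) {t : ℝ} (ht : t ∈ Set.Icc 0 T) (x : Torus d) :
    IntervalIntegrable (fun τ => heatAvg ν (t - τ) (g τ) x) volume 0 t := by
  have hc : Continuous fun τ : ℝ => heatAvg ν (t - τ) (g (Set.projIcc 0 T hT τ)) x :=
    continuous_heatAvg ν (f := fun τ y => g (Set.projIcc 0 T hT τ) y) (continuous_clamp hT hg)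
      (fun τ y => hC _ (Set.projIcc 0 T hT τ).2 y) (by fun_prop) continuous_const
  refine (hc.continuousOn.congr fun τ hτ => ?_).intervalIntegrable
  rw [Set.uIcc_of_le ht.1] at hτ
  rw [Set.projIcc_of_mem hT ⟨hτ.1, hτ.2.trans ht.2⟩]

lemma continuousOn_duhamel (hT : 0 ≤ T)
    (hg : ContinuousOn (fun p : ℝ × Torus d => g p.1 p.2) (Set.Icc 0 T ×ˢ Set.univ))
    (hC : ∀ t ∈ Set.Icc 0 T, ∀ x, |g t x| ≤ C) :
    ContinuousOn (fun p : ℝ × Torus d => ∫ τ in (0 : ℝ)..p.1, heatAvg ν (p.1 - τ) (g τ) p.2)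
      (Set.Icc 0 T ×ˢ Set.univ) := by
  -- Negative elapsed times are harmless: `wrap` contains √(2t), which is continuous on ℝ and zero
  -- for t < 0.
  have hc : Continuous fun q : (ℝ × Torus d) × ℝ =>
      heatAvg ν (q.1.1 - q.2) (g (Set.projIcc 0 T hT q.2)) q.1.2 :=
    continuous_heatAvg ν (f := fun q : (ℝ × Torus d) × ℝ => g (Set.projIcc 0 T hT q.2))
      ((continuous_clamp hT hg).comp (by fun_prop :
        Continuous fun p : ((ℝ × Torus d) × ℝ) × Torus d => (p.1.2, p.2)))
      (fun q y => hC _ (Set.projIcc 0 T hT q.2).2 y) (by fun_prop) (by fun_prop)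
  have hc2 : Continuous fun p : ℝ × Torus d => ∫ τ in (0 : ℝ)..p.1,
      heatAvg ν (p.1 - τ) (g (Set.projIcc 0 T hT τ)) p.2 :=
    intervalIntegral.continuous_parametric_intervalIntegral_of_continuous
      (f := fun (p : ℝ × Torus d) τ => heatAvg ν (p.1 - τ) (g (Set.projIcc 0 T hT τ)) p.2) hc
      continuous_fst
  refine hc2.continuousOn.congr fun p hp => ?_
  refine intervalIntegral.integral_congr fun τ hτ => ?_
  rw [Set.uIcc_of_le hp.1.1] at hτ
  simp only [Set.projIcc_of_mem hT ⟨hτ.1, hτ.2.trans hp.1.2⟩]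

end Duhamel

/-! ### The Picard map with averaged propagator -/

/-- Smallness conditions on the radii, the Lipschitz constant and the time horizon. -/
structure Admissible (R M L T δ : ℝ) : Prop where
  R_pos : 0 < R
  M_pos : 0 < M
  L_pos : 0 < L
  T_pos : 0 < T
  self_map : R + T * L * M ≤ M
  contraction : T * L ≤ δ
  lt_one : δ < 1

namespace Admissible

variable {R M L T δ : ℝ} (h : Admissible R M L T δ)

include h

lemma nonneg : 0 ≤ δ := (mul_pos h.T_pos h.L_pos).le.trans h.contraction

lemma one_sub_pos : 0 < 1 - δ := sub_pos.mpr h.lt_one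

end Admissible

/-- The Picard map with the propagator `heatAvg ν`. -/
noncomputable def avgPicard {d : ℕ} (ν : Measure (Torus d)) (F : ℝ → ℝ) (u₀ : C(Torus d, ℝ))
    (v : ℝ → Torus d → ℝ) : ℝ → Torus d → ℝ :=
  fun t x => heatAvg ν t u₀ x + ∫ τ in (0 : ℝ)..t, heatAvg ν (t - τ) (fun y => F (v τ y)) x

/-- The iterates of `avgPicard` started at zero. -/
noncomputable def avgIter {d : ℕ} (ν : Measure (Torus d)) (F : ℝ → ℝ) (ℓ : ℕ)
    (u₀ : C(Torus d, ℝ)) : ℝ → Torus d → ℝ :=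
  (avgPicard ν F u₀)^[ℓ] 0

section Picard

variable {d : ℕ} {R M L T δ : ℝ}

lemma avgIter_succ (ν : Measure (Torus d)) (F : ℝ → ℝ) (ℓ : ℕ) (u₀ : C(Torus d, ℝ)) :
    avgIter ν F (ℓ + 1) u₀ = avgPicard ν F u₀ (avgIter ν F ℓ u₀) :=
  Function.iterate_succ_apply' _ _ _

lemma solutionBall_mem_Icc {v : ℝ → Torus d → ℝ} (hv : v ∈ solutionBall d T M) {t : ℝ}
    (ht : t ∈ Set.Icc 0 T) (x : Torus d) : v t x ∈ Set.Icc (-M) M :=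
  abs_le.mp (hv.2 t ht x)

lemma solutionBall_congr {u v : ℝ → Torus d → ℝ} (hv : v ∈ solutionBall d T M)
    (h : ∀ t ∈ Set.Icc 0 T, ∀ x, u t x = v t x) : u ∈ solutionBall d T M :=
  ⟨hv.1.congr fun p hp => h p.1 hp.1 p.2, fun t ht x => by rw [h t ht x]; exact hv.2 t ht x⟩

lemma zero_mem_solutionBall (hM : 0 ≤ M) : (0 : ℝ → Torus d → ℝ) ∈ solutionBall d T M :=
  ⟨continuousOn_const, fun _ _ _ => by simpa using hM⟩

lemma continuousOn_nonlin {F : ℝ → ℝ} (hL : 0 ≤ L) (hF : F ∈ nonlinClass M L) :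
    ContinuousOn F (Set.Icc (-M) M) :=
  (LipschitzOnWith.of_dist_le_mul (K := ⟨L, hL⟩) hF.2).continuousOn

lemma continuousOn_comp_nonlin {F : ℝ → ℝ} (hL : 0 ≤ L) (hF : F ∈ nonlinClass M L)
    {v : ℝ → Torus d → ℝ} (hv : v ∈ solutionBall d T M) :
    ContinuousOn (fun p : ℝ × Torus d => F (v p.1 p.2)) (Set.Icc 0 T ×ˢ Set.univ) :=
  (continuousOn_nonlin hL hF).comp hv.1 fun _ hp => solutionBall_mem_Icc hv hp.1 _

lemma abs_comp_nonlin_le {F : ℝ → ℝ} (hM : 0 ≤ M) (hL : 0 ≤ L) (hF : F ∈ nonlinClass M L)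
    {v : ℝ → Torus d → ℝ} (hv : v ∈ solutionBall d T M) {t : ℝ} (ht : t ∈ Set.Icc 0 T)
    (x : Torus d) : |F (v t x)| ≤ L * M := by
  have h := hF.2 _ (solutionBall_mem_Icc hv ht x) 0 ⟨by linarith, hM⟩
  rw [hF.1, sub_zero, sub_zero] at h
  exact h.trans (mul_le_mul_of_nonneg_left (hv.2 t ht x) hL)

variable (h : Admissible R M L T δ) {F F' : ℝ → ℝ} (hF : F ∈ nonlinClass M L)
  (hF' : F' ∈ nonlinClass M L) (ν ν' : Measure (Torus d)) [IsProbabilityMeasure ν]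
  [IsProbabilityMeasure ν'] {v w : ℝ → Torus d → ℝ}

include h hF

lemma continuous_slice_nonlin (hv : v ∈ solutionBall d T M) {t : ℝ} (ht : t ∈ Set.Icc 0 T) :
    Continuous fun y => F (v t y) :=
  continuous_slice (g := fun t y => F (v t y)) (continuousOn_comp_nonlin h.L_pos.le hF hv) ht

include hF' in
/-- Comparison of two Picard maps through their integrands. -/
lemma avgPicard_dist {u₀ u₀' : C(Torus d, ℝ)} (hv : v ∈ solutionBall d T M)
    (hw : w ∈ solutionBall d T M) {t : ℝ} (ht : t ∈ Set.Icc 0 T) (x y : Torus d) {D E : ℝ}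
    (hE : |heatAvg ν t u₀ x - heatAvg ν' t u₀' y| ≤ E)
    (hD : ∀ τ ∈ Set.Icc 0 t, |heatAvg ν (t - τ) (fun y => F (v τ y)) x
      - heatAvg ν' (t - τ) (fun y => F' (w τ y)) y| ≤ D) :
    |avgPicard ν F u₀ v t x - avgPicard ν' F' u₀' w t y| ≤ E + T * D := by
  have hD0 : 0 ≤ D := (abs_nonneg _).trans (hD 0 ⟨le_rfl, ht.1⟩)
  have h1 := intervalIntegrable_heatAvg ν h.T_pos.le (continuousOn_comp_nonlin h.L_pos.le hF hv)
    (fun t ht x => abs_comp_nonlin_le h.M_pos.le h.L_pos.le hF hv ht x) ht x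
  have h2 := intervalIntegrable_heatAvg ν' h.T_pos.le (continuousOn_comp_nonlin h.L_pos.le hF' hw)
    (fun t ht x => abs_comp_nonlin_le h.M_pos.le h.L_pos.le hF' hw ht x) ht y
  have h3 : |∫ τ in (0 : ℝ)..t, (heatAvg ν (t - τ) (fun y => F (v τ y)) x
      - heatAvg ν' (t - τ) (fun y => F' (w τ y)) y)| ≤ D * t :=
    abs_intervalIntegral_le ht.1 hD
  rw [intervalIntegral.integral_sub h1 h2] at h3
  have h4 : D * t ≤ T * D := by
    rw [mul_comm]
    exact mul_le_mul_of_nonneg_right ht.2 hD0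
  rw [avgPicard, avgPicard, add_sub_add_comm]
  exact (abs_add_le _ _).trans (add_le_add hE (h3.trans h4))

/-- The linear part is at most R, and F(0) = 0 bounds the integrand by LM, so the total is at most R
+ TLM ≤ M. -/
lemma avgPicard_mem {u₀ : C(Torus d, ℝ)} (hu : u₀ ∈ initialBall d R)
    (hv : v ∈ solutionBall d T M) : avgPicard ν F u₀ v ∈ solutionBall d T M := by
  have hb : ∀ x, |u₀ x| ≤ R := fun x => (u₀.norm_coe_le_norm x).trans hu
  have hg := continuousOn_comp_nonlin h.L_pos.le hF hv
  have hC := fun t (ht : t ∈ Set.Icc 0 T) x =>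
    abs_comp_nonlin_le h.M_pos.le h.L_pos.le hF hv ht x
  refine ⟨ContinuousOn.add (Continuous.continuousOn ?_)
    (continuousOn_duhamel ν h.T_pos.le hg hC), fun t ht x => ?_⟩
  · exact continuous_heatAvg ν (X := ℝ × Torus d) (f := fun _ => u₀) (by fun_prop) (fun _ => hb)
      continuous_fst continuous_snd
  · have h1 : |∫ τ in (0 : ℝ)..t, heatAvg ν (t - τ) (fun y => F (v τ y)) x| ≤ L * M * t :=
      abs_intervalIntegral_le ht.1 fun τ hτ =>
        abs_heatAvg_le ν _ (hC τ ⟨hτ.1, hτ.2.trans ht.2⟩) x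
    have h2 : L * M * t ≤ T * L * M := by
      have := mul_le_mul_of_nonneg_left ht.2 (mul_pos h.L_pos h.M_pos).le
      linarith
    refine (abs_add_le _ _).trans ((add_le_add (abs_heatAvg_le ν t hb x) (h1.trans h2)).trans
      h.self_map)

lemma avgIter_mem {u₀ : C(Torus d, ℝ)} (hu : u₀ ∈ initialBall d R) (ℓ : ℕ) :
    avgIter ν F ℓ u₀ ∈ solutionBall d T M := by
  induction ℓ with
  | zero => exact zero_mem_solutionBall h.M_pos.le
  | succ ℓ ih => rw [avgIter_succ]; exact avgPicard_mem h hF ν hu ih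

/-- Agreement on the ball and on [0, T] suffices: the averaged iterates stay in the ball, and the
Picard integral up to t only sees times in [0, t]. -/
lemma iterate_eq_avgIter {u₀ : C(Torus d, ℝ)} (hu : u₀ ∈ initialBall d R)
    {Φ : (ℝ → Torus d → ℝ) → ℝ → Torus d → ℝ}
    (hΦ : ∀ v ∈ solutionBall d T M, ∀ t ∈ Set.Icc 0 T, ∀ x, Φ v t x = avgPicard ν F u₀ v t x)
    (ℓ : ℕ) : ∀ t ∈ Set.Icc 0 T, ∀ x, (Φ^[ℓ] 0) t x = avgIter ν F ℓ u₀ t x := by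
  induction ℓ with
  | zero => exact fun _ _ _ => rfl
  | succ ℓ ih =>
    intro t ht x
    rw [Function.iterate_succ_apply', avgIter_succ,
      hΦ _ (solutionBall_congr (avgIter_mem h hF ν hu ℓ) ih) t ht x, avgPicard, avgPicard]
    congr 1
    refine intervalIntegral.integral_congr fun τ hτ => ?_
    rw [Set.uIcc_of_le ht.1] at hτ
    simp only [ih τ ⟨hτ.1, hτ.2.trans ht.2⟩]

/-! ### The exact and truncated Picard maps as averaged Picard maps -/

lemma picardMap_eq {u₀ : C(Torus d, ℝ)} (hv : v ∈ solutionBall d T M) {t : ℝ}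
    (ht : t ∈ Set.Icc 0 T) (x : Torus d) :
    picardMap F u₀ v t x = avgPicard (Measure.dirac 0) F u₀ v t x := by
  rw [picardMap, avgPicard, heat_eq ht.1 u₀.continuous]
  congr 1
  refine intervalIntegral.integral_congr fun τ hτ => ?_
  rw [Set.uIcc_of_le ht.1] at hτ
  exact heat_eq (by linarith [hτ.2])
    (continuous_slice_nonlin h hF hv ⟨hτ.1, hτ.2.trans ht.2⟩) x

lemma truncPicardMap_eq (N : ℕ) {u₀ : C(Torus d, ℝ)} (hv : v ∈ solutionBall d T M) {t : ℝ}
    (ht : t ∈ Set.Icc 0 T) (x : Torus d) :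
    truncPicardMap N F u₀ v t x = avgPicard (fejerLaw d N) F u₀ v t x := by
  rw [truncPicardMap, avgPicard, truncHeat_eq N ht.1 u₀.continuous]
  congr 1
  refine intervalIntegral.integral_congr fun τ hτ => ?_
  rw [Set.uIcc_of_le ht.1] at hτ
  exact truncHeat_eq N (by linarith [hτ.2])
    (continuous_slice_nonlin h hF hv ⟨hτ.1, hτ.2.trans ht.2⟩) x

lemma picardIter_eq {u₀ : C(Torus d, ℝ)} (hu : u₀ ∈ initialBall d R) (ℓ : ℕ) :
    ∀ t ∈ Set.Icc 0 T, ∀ x, picardIter F ℓ u₀ t x = avgIter (Measure.dirac 0) F ℓ u₀ t x :=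
  iterate_eq_avgIter h hF _ hu (fun _ hv _ ht x => picardMap_eq h hF hv ht x) ℓ

lemma picardIter_mem {u₀ : C(Torus d, ℝ)} (hu : u₀ ∈ initialBall d R) (ℓ : ℕ) :
    picardIter F ℓ u₀ ∈ solutionBall d T M :=
  solutionBall_congr (avgIter_mem h hF _ hu ℓ) (picardIter_eq h hF hu ℓ)

omit hF in
lemma fno_eq {ρ : ReLUNet 1} (hρ : ρ.fn ∈ nonlinClass M L) {u₀ : C(Torus d, ℝ)}
    (hu : u₀ ∈ initialBall d R) (N ℓ : ℕ) :
    ∀ t ∈ Set.Icc 0 T, ∀ x, fno N ℓ ρ u₀ t x = avgIter (fejerLaw d N) ρ.fn ℓ u₀ t x :=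
  iterate_eq_avgIter h hρ _ hu (fun _ hv _ ht x => truncPicardMap_eq h hρ N hv ht x) ℓ

omit hF in
lemma fno_mem {ρ : ReLUNet 1} (hρ : ρ.fn ∈ nonlinClass M L) {u₀ : C(Torus d, ℝ)}
    (hu : u₀ ∈ initialBall d R) (N ℓ : ℕ) : fno N ℓ ρ u₀ ∈ solutionBall d T M :=
  solutionBall_congr (avgIter_mem h hρ _ hu ℓ) (fno_eq h hρ hu N ℓ)

lemma avgPicard_contraction {u₀ u₀' : C(Torus d, ℝ)} (hv : v ∈ solutionBall d T M)
    (hw : w ∈ solutionBall d T M) {D : ℝ}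
    (hD : ∀ t ∈ Set.Icc 0 T, ∀ x, |v t x - w t x| ≤ D) {t : ℝ} (ht : t ∈ Set.Icc 0 T)
    (x : Torus d) :
    |avgPicard ν F u₀ v t x - avgPicard ν F u₀' w t x| ≤ ‖u₀ - u₀'‖ + δ * D := by
  have hD0 : 0 ≤ D := (abs_nonneg _).trans (hD t ht x)
  refine (avgPicard_dist h hF hF ν ν hv hw ht x x (E := ‖u₀ - u₀'‖) (D := L * D)
    (heatAvg_dist ν t u₀.continuous u₀'.continuous x x fun s =>
      (u₀ - u₀').norm_coe_le_norm (x - s)) fun τ hτ => ?_).trans ?_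
  · have hτ' : τ ∈ Set.Icc 0 T := ⟨hτ.1, hτ.2.trans ht.2⟩
    refine heatAvg_dist ν _ (continuous_slice_nonlin h hF hv hτ')
      (continuous_slice_nonlin h hF hw hτ') x x fun s => ?_
    exact (hF.2 _ (solutionBall_mem_Icc hv hτ' _) _ (solutionBall_mem_Icc hw hτ' _)).trans
      (mul_le_mul_of_nonneg_left (hD τ hτ' _) h.L_pos.le)
  · have := mul_le_mul_of_nonneg_right h.contraction hD0
    linarith

/-- The constant c = (1 - δ)⁻¹ solves c = 1 + δc, so the induction closes uniformly in ℓ. -/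
lemma avgIter_lipschitz {u₀ u₀' : C(Torus d, ℝ)} (hu : u₀ ∈ initialBall d R)
    (hu' : u₀' ∈ initialBall d R) (ℓ : ℕ) : ∀ t ∈ Set.Icc 0 T, ∀ x,
    |avgIter ν F ℓ u₀ t x - avgIter ν F ℓ u₀' t x| ≤ (1 - δ)⁻¹ * ‖u₀ - u₀'‖ := by
  have h1 := h.one_sub_pos
  induction ℓ with
  | zero =>
    intro t _ x
    simp only [avgIter, Function.iterate_zero, id, sub_self, abs_zero]
    positivity
  | succ ℓ ih =>
    intro t ht x
    rw [avgIter_succ, avgIter_succ]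
    refine (avgPicard_contraction h hF ν (avgIter_mem h hF ν hu ℓ) (avgIter_mem h hF ν hu' ℓ) ih
      ht x).trans (le_of_eq ?_)
    field_simp
    ring

/-- The Picard iterates inherit the translation modulus of the initial datum. -/
lemma avgIter_modulus {u₀ : C(Torus d, ℝ)} (hu : u₀ ∈ initialBall d R) {s : Torus d} {ω : ℝ}
    (hω : ∀ x, |u₀ (x - s) - u₀ x| ≤ ω) (ℓ : ℕ) : ∀ t ∈ Set.Icc 0 T, ∀ x,
    |avgIter ν F ℓ u₀ t (x - s) - avgIter ν F ℓ u₀ t x| ≤ (1 - δ)⁻¹ * ω := by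
  have h1 := h.one_sub_pos
  have hω0 : 0 ≤ ω := (abs_nonneg _).trans (hω 0)
  induction ℓ with
  | zero =>
    intro t _ x
    simp only [avgIter, Function.iterate_zero, id, Pi.zero_apply, sub_self, abs_zero]
    positivity
  | succ ℓ ih =>
    intro t ht x
    have hv := avgIter_mem h hF ν hu ℓ
    rw [avgIter_succ]
    -- The map is compared with itself at two base points, using that averaging commutes with
    -- translation.
    refine (avgPicard_dist h hF hF ν ν hv hv ht (x - s) x (E := ω)
      (D := L * ((1 - δ)⁻¹ * ω)) ?_ fun τ hτ => ?_).trans ?_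
    · refine heatAvg_dist ν t u₀.continuous u₀.continuous _ _ fun r => ?_
      rw [sub_right_comm]
      exact hω _
    · have hτ' : τ ∈ Set.Icc 0 T := ⟨hτ.1, hτ.2.trans ht.2⟩
      have hc := continuous_slice_nonlin h hF hv hτ'
      refine heatAvg_dist ν _ hc hc _ _ fun r => ?_
      rw [sub_right_comm]
      exact (hF.2 _ (solutionBall_mem_Icc hv hτ' _) _ (solutionBall_mem_Icc hv hτ' _)).trans
        (mul_le_mul_of_nonneg_left (ih τ hτ' _) h.L_pos.le)
    · have h2 := mul_le_mul_of_nonneg_right h.contraction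
        (mul_nonneg (inv_nonneg.mpr h1.le) hω0)
      have h3 : ω + δ * ((1 - δ)⁻¹ * ω) = (1 - δ)⁻¹ * ω := by field_simp; ring
      linarith

/-! ### The fixed point -/

/-- A fixed point is approximated geometrically by the iterates. -/
lemma abs_sub_avgIter_le {u₀ : C(Torus d, ℝ)} (hu : u₀ ∈ initialBall d R)
    {u : ℝ → Torus d → ℝ} (hmem : u ∈ solutionBall d T M)
    (hfix : ∀ t ∈ Set.Icc 0 T, ∀ x, u t x = avgPicard ν F u₀ u t x) (ℓ : ℕ) :
    ∀ t ∈ Set.Icc 0 T, ∀ x, |u t x - avgIter ν F ℓ u₀ t x| ≤ M * δ ^ ℓ := by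
  induction ℓ with
  | zero =>
    intro t ht x
    simpa [avgIter] using hmem.2 t ht x
  | succ ℓ ih =>
    intro t ht x
    rw [avgIter_succ, hfix t ht x]
    refine (avgPicard_contraction h hF ν hmem (avgIter_mem h hF ν hu ℓ) ih ht x).trans
      (le_of_eq ?_)
    rw [sub_self, norm_zero]
    ring

lemma tendsto_avgIter {u₀ : C(Torus d, ℝ)} (hu : u₀ ∈ initialBall d R)
    {u : ℝ → Torus d → ℝ} (hmem : u ∈ solutionBall d T M)
    (hfix : ∀ t ∈ Set.Icc 0 T, ∀ x, u t x = avgPicard ν F u₀ u t x) {t : ℝ}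
    (ht : t ∈ Set.Icc 0 T) (x : Torus d) :
    Tendsto (fun ℓ => avgIter ν F ℓ u₀ t x) atTop (𝓝 (u t x)) := by
  have h1 : Tendsto (fun ℓ => M * δ ^ ℓ) atTop (𝓝 0) := by
    simpa using (tendsto_pow_atTop_nhds_zero_of_lt_one h.nonneg h.lt_one).const_mul M
  rw [tendsto_iff_dist_tendsto_zero]
  refine squeeze_zero (fun _ => dist_nonneg) (fun ℓ => ?_) h1
  rw [dist_comm]
  exact abs_sub_avgIter_le h hF ν hu hmem hfix ℓ t ht x

/-- Banach's argument carried out pointwise: the iterates are geometrically Cauchy, the uniform rate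
makes the limit continuous, and the shifted sequence converges both to u and to the image of u. -/
lemma exists_fixedPoint {u₀ : C(Torus d, ℝ)} (hu : u₀ ∈ initialBall d R) :
    ∃ u ∈ solutionBall d T M, ∀ t ∈ Set.Icc 0 T, ∀ x, u t x = avgPicard ν F u₀ u t x := by
  have hstep : ∀ ℓ, ∀ t ∈ Set.Icc 0 T, ∀ x,
      |avgIter ν F ℓ u₀ t x - avgIter ν F (ℓ + 1) u₀ t x| ≤ M * δ ^ ℓ := by
    intro ℓ
    induction ℓ with
    | zero =>
      intro t ht x
      simpa [avgIter] using (avgIter_mem h hF ν hu 1).2 t ht x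
    | succ ℓ ih =>
      intro t ht x
      rw [avgIter_succ ν F ℓ, avgIter_succ ν F (ℓ + 1)]
      refine (avgPicard_contraction h hF ν (avgIter_mem h hF ν hu ℓ)
        (avgIter_mem h hF ν hu (ℓ + 1)) ih ht x).trans (le_of_eq ?_)
      rw [sub_self, norm_zero]
      ring
  have hlim : ∀ t ∈ Set.Icc 0 T, ∀ x, ∃ y,
      Tendsto (fun ℓ => avgIter ν F ℓ u₀ t x) atTop (𝓝 y) := fun t ht x =>
    cauchySeq_tendsto_of_complete
      (cauchySeq_of_le_geometric δ M h.lt_one fun ℓ => hstep ℓ t ht x)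
  -- Values outside [0, T] are arbitrary and never used.
  choose! u hu' using hlim
  have hdist : ∀ ℓ, ∀ t ∈ Set.Icc 0 T, ∀ x,
      |u t x - avgIter ν F ℓ u₀ t x| ≤ M * δ ^ ℓ / (1 - δ) := fun ℓ t ht x => by
    have := dist_le_of_le_geometric_of_tendsto δ M h.lt_one (fun ℓ => hstep ℓ t ht x)
      (hu' t ht x) ℓ
    rwa [dist_comm] at this
  have hsmall : Tendsto (fun ℓ => M * δ ^ ℓ / (1 - δ)) atTop (𝓝 0) := by
    simpa using ((tendsto_pow_atTop_nhds_zero_of_lt_one h.nonneg h.lt_one).const_mul M).div_const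
      (1 - δ)
  have hmem : u ∈ solutionBall d T M := by
    constructor
    · refine TendstoUniformlyOn.continuousOn
        (F := fun ℓ (p : ℝ × Torus d) => avgIter ν F ℓ u₀ p.1 p.2) (p := atTop) ?_
        (Eventually.frequently (Eventually.of_forall fun ℓ => (avgIter_mem h hF ν hu ℓ).1))
      rw [Metric.tendstoUniformlyOn_iff]
      intro ε hε
      filter_upwards [hsmall.eventually_lt_const hε] with ℓ hℓ p hp
      exact (hdist ℓ p.1 hp.1 p.2).trans_lt hℓ
    · intro t ht x
      exact le_of_tendsto (hu' t ht x).abs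
        (Eventually.of_forall fun ℓ => (avgIter_mem h hF ν hu ℓ).2 t ht x)
  refine ⟨u, hmem, fun t ht x => ?_⟩
  refine tendsto_nhds_unique ((tendsto_add_atTop_iff_nat 1).mpr (hu' t ht x)) ?_
  rw [tendsto_iff_dist_tendsto_zero]
  refine squeeze_zero (fun _ => dist_nonneg) (fun ℓ => ?_)
    (by simpa using hsmall.const_mul δ)
  rw [avgIter_succ, dist_comm, Real.dist_eq]
  refine (avgPicard_contraction h hF ν hmem (avgIter_mem h hF ν hu ℓ) (hdist ℓ) ht x).trans
    (le_of_eq ?_)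
  rw [sub_self, norm_zero, zero_add]

lemma isMildSolution_iff {u₀ : C(Torus d, ℝ)} {u : ℝ → Torus d → ℝ} :
    IsMildSolution T M F u₀ u ↔ u ∈ solutionBall d T M ∧
      ∀ t ∈ Set.Icc 0 T, ∀ x, u t x = avgPicard (Measure.dirac 0) F u₀ u t x :=
  and_congr_right fun hu => forall₃_congr fun t ht x => by rw [picardMap_eq h hF hu ht x]

lemma isMildSolution_solOp {u₀ : C(Torus d, ℝ)} (hu : u₀ ∈ initialBall d R) :
    IsMildSolution T M F u₀ (solOp T M F u₀) := by
  obtain ⟨u, hu1, hu2⟩ := exists_fixedPoint h hF (Measure.dirac 0) hu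
  have hex : ∃ u, IsMildSolution T M F u₀ u := ⟨u, (isMildSolution_iff h hF).mpr ⟨hu1, hu2⟩⟩
  rw [solOp, dif_pos hex]
  exact hex.choose_spec

/-- Any two fixed points in the ball are limits of the same iterates. -/
lemma eq_solOp {u₀ : C(Torus d, ℝ)} (hu : u₀ ∈ initialBall d R) {u : ℝ → Torus d → ℝ}
    (hsol : IsMildSolution T M F u₀ u) : ∀ t ∈ Set.Icc 0 T, ∀ x, u t x = solOp T M F u₀ t x := by
  intro t ht x
  obtain ⟨h1, h2⟩ := (isMildSolution_iff h hF).mp hsol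
  obtain ⟨h3, h4⟩ := (isMildSolution_iff h hF).mp (isMildSolution_solOp h hF hu)
  exact tendsto_nhds_unique (tendsto_avgIter h hF _ hu h1 h2 ht x)
    (tendsto_avgIter h hF _ hu h3 h4 ht x)

/-! ### Joint continuity in the initial datum and the space-time point -/

/-- Initial data and space-time points on which all operators are continuous. -/
def opDomain (d : ℕ) (R T : ℝ) : Set (C(Torus d, ℝ) × (Torus d × ℝ)) :=
  initialBall d R ×ˢ (Set.univ ×ˢ Set.Icc 0 T)

/-- Continuity in the space-time point for each datum, together with a Lipschitz bound in the datum
uniform in the point, gives joint continuity. This supplies measurability of the squared errors. -/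
lemma continuousOn_avgIter (ℓ : ℕ) :
    ContinuousOn (fun p : C(Torus d, ℝ) × (Torus d × ℝ) => avgIter ν F ℓ p.1 p.2.2 p.2.1)
      (opDomain d R T) := by
  have h1 := h.one_sub_pos
  refine continuousOn_prod_of_continuousOn_lipschitzOnWith _
    (⟨(1 - δ)⁻¹, inv_nonneg.mpr h1.le⟩ : NNReal) (fun u₀ hu => ?_) fun z hz => ?_
  · exact (avgIter_mem h hF ν hu ℓ).1.comp continuous_swap.continuousOn
      fun z hz => ⟨hz.2, trivial⟩
  · exact LipschitzOnWith.of_dist_le_mul fun u hu u' hu' => by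
      rw [dist_eq_norm u u']
      exact avgIter_lipschitz h hF ν hu hu' ℓ z.2 hz.2 z.1

/-- The solution is the limit of the iterates, uniformly in datum and point; the choice inside
`solOp` therefore does no harm on this domain. -/
lemma continuousOn_solOp :
    ContinuousOn (fun p : C(Torus d, ℝ) × (Torus d × ℝ) => solOp T M F p.1 p.2.2 p.2.1)
      (opDomain d R T) := by
  refine TendstoUniformlyOn.continuousOn
    (F := fun ℓ (p : C(Torus d, ℝ) × (Torus d × ℝ)) =>
      avgIter (Measure.dirac 0) F ℓ p.1 p.2.2 p.2.1) (p := atTop) ?_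
    (Eventually.frequently (Eventually.of_forall fun ℓ => continuousOn_avgIter h hF _ ℓ))
  have hsmall : Tendsto (fun ℓ => M * δ ^ ℓ) atTop (𝓝 0) := by
    simpa using (tendsto_pow_atTop_nhds_zero_of_lt_one h.nonneg h.lt_one).const_mul M
  rw [Metric.tendstoUniformlyOn_iff]
  intro ε hε
  filter_upwards [hsmall.eventually_lt_const hε] with ℓ hℓ p hp
  obtain ⟨h1, h2⟩ := (isMildSolution_iff h hF).mp (isMildSolution_solOp h hF hp.1)
  exact (abs_sub_avgIter_le h hF _ hp.1 h1 h2 ℓ p.2.2 hp.2.2 p.2.1).trans_lt hℓ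

lemma continuousOn_picardIter (ℓ : ℕ) :
    ContinuousOn (fun p : C(Torus d, ℝ) × (Torus d × ℝ) => picardIter F ℓ p.1 p.2.2 p.2.1)
      (opDomain d R T) :=
  (continuousOn_avgIter h hF (Measure.dirac 0) ℓ).congr fun p hp =>
    picardIter_eq h hF hp.1 ℓ p.2.2 hp.2.2 p.2.1

omit hF in
lemma continuousOn_fno {ρ : ReLUNet 1} (hρ : ρ.fn ∈ nonlinClass M L) (N ℓ : ℕ) :
    ContinuousOn (fun p : C(Torus d, ℝ) × (Torus d × ℝ) => fno N ℓ ρ p.1 p.2.2 p.2.1)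
      (opDomain d R T) :=
  (continuousOn_avgIter h hρ (fejerLaw d N) ℓ).congr fun p hp =>
    fno_eq h hρ hp.1 N ℓ p.2.2 hp.2.2 p.2.1

/-! ### The effect of cutoff and network error on the iterates -/

include hF' in
-- One step adds B from cutting off the datum, and under the time integral LE from the previous
-- error, η from the network and L(1 - δ)⁻¹B from cutting off F of the exact iterate. The cutoff is
-- compared with the identity only on the exact iterate, whose translation modulus is known. With TL
-- ≤ δ this yields E ↦ δE + Tη + (1 - δ)⁻¹B.
lemma avgIter_error {η : ℝ} (hη : ∀ y ∈ Set.Icc (-M) M, |F y - F' y| ≤ η)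
    {u₀ : C(Torus d, ℝ)} (hu : u₀ ∈ initialBall d R) {ω : Torus d → ℝ} (hint : Integrable ω ν)
    (hω : ∀ s x, |u₀ (x - s) - u₀ x| ≤ ω s) (ℓ : ℕ) : ∀ t ∈ Set.Icc 0 T, ∀ x,
    |avgIter ν F' ℓ u₀ t x - avgIter (Measure.dirac 0) F ℓ u₀ t x|
      ≤ (1 - δ ^ ℓ) / (1 - δ) * (T * η + (1 - δ)⁻¹ * ∫ s, ω s ∂ν) := by
  have h1 := h.one_sub_pos
  set B : ℝ := ∫ s, ω s ∂ν with hB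
  have hB0 : 0 ≤ B := integral_nonneg fun s => (abs_nonneg _).trans (hω s 0)
  induction ℓ with
  | zero =>
    intro t _ x
    simp [avgIter]
  | succ ℓ ih =>
    intro t ht x
    set E : ℝ := (1 - δ ^ ℓ) / (1 - δ) * (T * η + (1 - δ)⁻¹ * B) with hE
    have hE0 : 0 ≤ E := (abs_nonneg _).trans (ih t ht x)
    have hv := avgIter_mem h hF (Measure.dirac 0) hu ℓ
    have hw := avgIter_mem h hF' ν hu ℓ
    rw [avgIter_succ, avgIter_succ]
    refine (avgPicard_dist h hF' hF ν (Measure.dirac 0) hw hv ht x x (E := B)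
      (D := L * E + η + L * ((1 - δ)⁻¹ * B)) ?_ fun τ hτ => ?_).trans ?_
    · exact heatAvg_sub_dirac ν t u₀.continuous hint hω x
    · have hτ' : τ ∈ Set.Icc 0 T := ⟨hτ.1, hτ.2.trans ht.2⟩
      have hcv := continuous_slice_nonlin h hF hv hτ'
      have hcw := continuous_slice_nonlin h hF' hw hτ'
      have e1 := heatAvg_dist ν (t - τ) hcw hcv x x (D := L * E + η) fun s => by
        have a1 := hF'.2 _ (solutionBall_mem_Icc hw hτ' (x - s)) _
          (solutionBall_mem_Icc hv hτ' (x - s))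
        have a2 := mul_le_mul_of_nonneg_left (ih τ hτ' (x - s)) h.L_pos.le
        have a3 := hη _ (solutionBall_mem_Icc hv hτ' (x - s))
        rw [abs_sub_comm] at a3
        exact (abs_sub_le _ _ _).trans (add_le_add (a1.trans a2) a3)
      have e2 := heatAvg_sub_dirac ν (t - τ) hcv (ω := fun s => L * ((1 - δ)⁻¹ * ω s))
        ((hint.const_mul _).const_mul _) (fun s y =>
          (hF.2 _ (solutionBall_mem_Icc hv hτ' _) _ (solutionBall_mem_Icc hv hτ' _)).trans
            (mul_le_mul_of_nonneg_left
              (avgIter_modulus h hF _ hu (hω s) ℓ τ hτ' y) h.L_pos.le)) x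
      rw [integral_const_mul, integral_const_mul] at e2
      exact (abs_sub_le _ _ _).trans (add_le_add e1 e2)
    · have h2 := mul_le_mul_of_nonneg_right h.contraction hE0
      have h3 := mul_le_mul_of_nonneg_right h.contraction
        (mul_nonneg (inv_nonneg.mpr h1.le) hB0)
      have h4 : B + δ * ((1 - δ)⁻¹ * B) = (1 - δ)⁻¹ * B := by field_simp; ring
      have h5 : (1 - δ ^ (ℓ + 1)) / (1 - δ) * (T * η + (1 - δ)⁻¹ * B)
          = δ * E + (T * η + (1 - δ)⁻¹ * B) := by
        rw [hE]; field_simp; ring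
      rw [h5]
      linarith

end Picard

/-! ### The translation modulus of Sobolev functions -/

/-- The difference of the two sides is a multiple of (lpc - b)². It replaces Cauchy–Schwarz for
series by a termwise bound with a free parameter l. -/
lemma young_weighted {l p : ℝ} (hl : 0 < l) (hp : 0 < p) (c b : ℝ) :
    c * b ≤ l / 2 * (p * c ^ 2) + (2 * l)⁻¹ * (p⁻¹ * b ^ 2) := by
  have h1 : l / 2 * (p * c ^ 2) + (2 * l)⁻¹ * (p⁻¹ * b ^ 2) - c * b
      = (2 * l * p)⁻¹ * (l * p * c - b) ^ 2 := by
    field_simp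
    ring
  have h2 : 0 ≤ (2 * l * p)⁻¹ * (l * p * c - b) ^ 2 := by positivity
  linarith

lemma summable_of_mem_sobolevBall {d : ℕ} {s R₀ : ℝ} (hR : 0 ≤ R₀) {u : C(Torus d, ℝ)}
    (hu : u ∈ sobolevBall d s R₀) :
    Summable (fun ξ => (1 + freqSq ξ) ^ s * ‖coeff u ξ‖ ^ 2) ∧
      ∑' ξ, (1 + freqSq ξ) ^ s * ‖coeff u ξ‖ ^ 2 ≤ R₀ ^ 2 := by
  have hnn : ∀ ξ, 0 ≤ (1 + freqSq ξ) ^ s * ‖coeff u ξ‖ ^ 2 := fun ξ => by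
    have := freqSq_nonneg ξ
    positivity
  have h1 : ∑' ξ, ENNReal.ofReal ((1 + freqSq ξ) ^ s * ‖coeff u ξ‖ ^ 2)
      ≤ ENNReal.ofReal (R₀ ^ 2) := by
    have h := ENNReal.rpow_le_rpow (z := 2) hu zero_le_two
    rw [sobolevNorm, ← ENNReal.rpow_mul] at h
    norm_num at h
    rwa [← ENNReal.ofReal_pow hR] at h
  have h2 : ∀ S : Finset (Fin d → ℤ), ∑ ξ ∈ S, (1 + freqSq ξ) ^ s * ‖coeff u ξ‖ ^ 2 ≤ R₀ ^ 2 := by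
    intro S
    have h3 := (ENNReal.sum_le_tsum S).trans h1
    rw [← ENNReal.ofReal_sum_of_nonneg fun ξ _ => hnn ξ] at h3
    exact (ENNReal.ofReal_le_ofReal_iff (sq_nonneg _)).mp h3
  exact ⟨summable_of_sum_le hnn h2, Real.tsum_le_of_sum_le hnn h2⟩

/-- The terms of the squared modulus of continuity of the unit ball of `H^s`. -/
noncomputable def sobolevModTerm {d : ℕ} (s : ℝ) (ξ : Fin d → ℤ) (h : Torus d) : ℝ :=
  (1 + freqSq ξ) ^ (-s) * (nrm d * ‖chi ξ h - 1‖) ^ 2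

/-- The squared modulus of continuity of the unit ball of `H^s`. -/
noncomputable def sobolevMod {d : ℕ} (s : ℝ) (h : Torus d) : ℝ := ∑' ξ, sobolevModTerm s ξ h

lemma sobolevModTerm_nonneg {d : ℕ} (s : ℝ) (ξ : Fin d → ℤ) (h : Torus d) :
    0 ≤ sobolevModTerm s ξ h := by
  have := freqSq_nonneg ξ
  unfold sobolevModTerm
  positivity

lemma sobolevModTerm_le {d : ℕ} (s : ℝ) (ξ : Fin d → ℤ) (h : Torus d) :
    sobolevModTerm s ξ h ≤ (1 + freqSq ξ) ^ (-s) * (nrm d * 2) ^ 2 := by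
  have h1 := freqSq_nonneg ξ
  have h2 : ‖chi ξ h - 1‖ ≤ 2 := (norm_sub_le _ _).trans (by rw [norm_chi, norm_one]; norm_num)
  have h3 := nrm_pos d
  unfold sobolevModTerm
  gcongr

lemma continuous_sobolevModTerm {d : ℕ} (s : ℝ) (ξ : Fin d → ℤ) :
    Continuous (sobolevModTerm s ξ) := by
  unfold sobolevModTerm
  fun_prop

section SobolevMod

variable {d : ℕ} {s : ℝ} (hs : (d : ℝ) / 2 < s)

include hs

lemma summable_sobolevModTerm (h : Torus d) : Summable fun ξ => sobolevModTerm s ξ h :=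
  Summable.of_nonneg_of_le (fun _ => sobolevModTerm_nonneg _ _ _)
    (fun _ => sobolevModTerm_le _ _ _) ((summable_sobolev_weight hs).mul_right _)

lemma continuous_sobolevMod : Continuous (sobolevMod (d := d) s) :=
  continuous_tsum (continuous_sobolevModTerm s) ((summable_sobolev_weight hs).mul_right _)
    fun ξ h => by
      rw [Real.norm_of_nonneg (sobolevModTerm_nonneg _ _ _)]
      exact sobolevModTerm_le _ _ _

/-- A shift multiplies the coefficients by a conjugated character, so each term of the difference
pairs a Sobolev term with a term of `sobolevMod`. The bound is affine in `sobolevMod`, hence can be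
integrated directly against the Fejér law. -/
lemma abs_sub_le_of_mem_sobolevBall {R₀ : ℝ} (hR : 0 ≤ R₀) {u : C(Torus d, ℝ)}
    (hu : u ∈ sobolevBall d s R₀) {l : ℝ} (hl : 0 < l) (h x : Torus d) :
    |u (x - h) - u x| ≤ l / 2 * R₀ ^ 2 + (2 * l)⁻¹ * sobolevMod s h := by
  obtain ⟨h1, h2⟩ := summable_of_mem_sobolevBall hR hu
  have hp : ∀ ξ : Fin d → ℤ, 0 < (1 + freqSq ξ) ^ s := fun ξ => by
    have := freqSq_nonneg ξ
    positivity
  have hinv : ∀ ξ : Fin d → ℤ, (1 + freqSq ξ) ^ (-s) = ((1 + freqSq ξ) ^ s)⁻¹ := fun ξ =>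
    Real.rpow_neg (by have := freqSq_nonneg ξ; positivity) s
  have hsum : Summable fun ξ => ‖coeff u ξ‖ := by
    refine Summable.of_nonneg_of_le (fun _ => norm_nonneg _) (fun ξ => ?_)
      ((h1.mul_left (1 / 2)).add ((summable_sobolev_weight hs).mul_left (2 * 1)⁻¹))
    have := young_weighted one_pos (hp ξ) ‖coeff u ξ‖ 1
    rw [hinv]
    simpa using this
  have h3 := (hasSum_of_summable_coeff u.continuous hsum (x - h)).sub
    (hasSum_of_summable_coeff u.continuous hsum x)
  have h4 := (h1.hasSum.mul_left (l / 2)).add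
    ((summable_sobolevModTerm hs h).hasSum.mul_left (2 * l)⁻¹)
  have h5 := HasSum.norm_le_of_bounded h3 h4 fun ξ => by
    have e1 : coeff u ξ * e ξ (x - h) - coeff u ξ * e ξ x
        = coeff u ξ * (nrm d * chi ξ x * conj (chi ξ h - 1)) := by
      rw [e_eq, e_eq, chi_sub, map_sub, map_one]
      ring
    rw [e1, norm_mul, norm_mul, norm_mul, norm_chi, mul_one, RCLike.norm_conj, Complex.norm_real,
      Real.norm_of_nonneg (nrm_pos d).le, sobolevModTerm, hinv]
    exact young_weighted hl (hp ξ) _ _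
  rw [← Complex.ofReal_sub, Complex.norm_real, Real.norm_eq_abs] at h5
  refine h5.trans (add_le_add (mul_le_mul_of_nonneg_left h2 (by positivity)) le_rfl)

end SobolevMod

/-! ### Decay of the Fejér cutoff error -/

lemma fejerWeight_mem (N : ℕ) (n : ℤ) : fejerWeight N n ∈ Set.Icc 0 1 :=
  ⟨le_max_right _ _, max_le (sub_le_self _ (by positivity)) zero_le_one⟩

lemma fejerSymbol_mem {d : ℕ} (N : ℕ) (ξ : Fin d → ℤ) : fejerSymbol N ξ ∈ Set.Icc 0 1 :=
  ⟨Finset.prod_nonneg fun _ _ => (fejerWeight_mem N _).1,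
    Finset.prod_le_one (fun _ _ => (fejerWeight_mem N _).1) fun _ _ => (fejerWeight_mem N _).2⟩

lemma tendsto_fejerSymbol {d : ℕ} (ξ : Fin d → ℤ) :
    Tendsto (fun N => fejerSymbol N ξ) atTop (𝓝 1) := by
  have h1 : ∀ r, Tendsto (fun N : ℕ => max (1 - |(ξ r : ℝ)| / ((N : ℝ) + 1)) 0) atTop (𝓝 1) := by
    intro r
    have h2 : Tendsto (fun N : ℕ => |(ξ r : ℝ)| / ((N : ℝ) + 1)) atTop (𝓝 0) :=
      tendsto_const_nhds.div_atTop (tendsto_natCast_atTop_atTop.atTop_add tendsto_const_nhds)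
    simpa using (h2.const_sub 1).max (tendsto_const_nhds (x := (0 : ℝ)))
  simpa [fejerSymbol] using tendsto_finsetProd Finset.univ fun r _ => h1 r

/-- Since |χ| = 1, |χ - 1|² = 2(1 - Re χ), and the Fejér mean of χ is the symbol. -/
lemma integral_sobolevModTerm {d : ℕ} (s : ℝ) (N : ℕ) (ξ : Fin d → ℤ) :
    ∫ h, sobolevModTerm s ξ h ∂(fejerLaw d N)
      = (1 + freqSq ξ) ^ (-s) * (nrm d ^ 2 * (2 * (1 - fejerSymbol N ξ))) := by
  have h1 : ∀ h, sobolevModTerm s ξ h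
      = (1 + freqSq ξ) ^ (-s) * (nrm d ^ 2 * (2 * (1 - (chi ξ h).re))) := fun h => by
    have h2 : ‖chi ξ h - 1‖ ^ 2 = 2 * (1 - (chi ξ h).re) := by
      have h3 := norm_chi ξ h
      rw [← sq_eq_sq₀ (norm_nonneg _) zero_le_one, ← Complex.normSq_eq_norm_sq,
        Complex.normSq_apply] at h3
      rw [← Complex.normSq_eq_norm_sq, Complex.normSq_apply]
      simp only [Complex.sub_re, Complex.sub_im, Complex.one_re, Complex.one_im]
      linarith
    rw [sobolevModTerm, mul_pow, h2]
  have hint : Integrable (fun h => (chi ξ h).re) (fejerLaw d N) :=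
    integrable_torus _ (Complex.continuous_re.comp (chi ξ).continuous)
  have h4 : ∫ h, (chi ξ h).re ∂(fejerLaw d N) = fejerSymbol N ξ := by
    have := integral_re (integrable_torus (fejerLaw d N) (chi ξ).continuous)
    rw [integral_fejerLaw] at this
    simpa using this
  simp only [h1]
  rw [integral_const_mul, integral_const_mul, integral_const_mul,
    integral_sub (integrable_const _) hint, h4]
  simp

/-- The symbol tends to 1 at each frequency; the summable Sobolev weight dominates the series. -/
lemma tendsto_integral_sobolevMod {d : ℕ} {s : ℝ} (hs : (d : ℝ) / 2 < s) :
    Tendsto (fun N => ∫ h, sobolevMod (d := d) s h ∂(fejerLaw d N)) atTop (𝓝 0) := by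
  have h1 : ∀ N, ∫ h, sobolevMod (d := d) s h ∂(fejerLaw d N)
      = ∑' ξ : Fin d → ℤ,
        (1 + freqSq ξ) ^ (-s) * (nrm d ^ 2 * (2 * (1 - fejerSymbol N ξ))) := fun N => by
    simp only [← integral_sobolevModTerm]
    refine (integral_tsum_of_summable_integral_norm
      (fun ξ => integrable_torus _ (continuous_sobolevModTerm s ξ)) ?_).symm
    refine Summable.of_nonneg_of_le (fun _ => integral_nonneg fun _ => norm_nonneg _) (fun ξ => ?_)
      ((summable_sobolev_weight hs).mul_right ((nrm d * 2) ^ 2))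
    refine (le_abs_self _).trans (abs_integral_le_of_forall _ fun h => ?_)
    rw [abs_norm, Real.norm_of_nonneg (sobolevModTerm_nonneg _ _ _)]
    exact sobolevModTerm_le _ _ _
  simp only [h1]
  have h2 : ∑' ξ : Fin d → ℤ, (1 + freqSq ξ) ^ (-s) * (nrm d ^ 2 * (2 * (1 - (1 : ℝ)))) = 0 := by
    simp
  rw [← h2]
  refine tendsto_tsum_of_dominated_convergence
    ((summable_sobolev_weight hs).mul_right (nrm d ^ 2 * 2)) (fun ξ => ?_)
    (Eventually.of_forall fun N ξ => ?_)
  · exact (((tendsto_fejerSymbol ξ).const_sub 1).const_mul 2 |>.const_mul _).const_mul _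
  · obtain ⟨h3, h4⟩ := fejerSymbol_mem N ξ
    have h5 := freqSq_nonneg ξ
    have h6 : 0 ≤ 1 - fejerSymbol N ξ := sub_nonneg.mpr h4
    rw [Real.norm_of_nonneg (by positivity)]
    have h7 : 2 * (1 - fejerSymbol N ξ) ≤ 2 := by linarith
    gcongr

/-- The Fejér cutoff error is uniformly small on Sobolev balls and on everything inheriting their
translation modulus. -/
lemma exists_cutoff_bound {d : ℕ} {s R₀ : ℝ} (hs : (d : ℝ) / 2 < s) (hR : 0 ≤ R₀) :
    ∃ b : ℕ → ℝ, Tendsto b atTop (𝓝 0) ∧ ∀ N, ∃ ω : Torus d → ℝ,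
      Integrable ω (fejerLaw d N) ∧ ∫ h, ω h ∂(fejerLaw d N) ≤ b N ∧
      ∀ u ∈ sobolevBall d s R₀, ∀ h x, |u (x - h) - u x| ≤ ω h := by
  set V : ℕ → ℝ := fun N => ∫ h, sobolevMod (d := d) s h ∂(fejerLaw d N) with hV
  have hV0 : ∀ N, 0 ≤ V N := fun N =>
    integral_nonneg fun h => tsum_nonneg fun ξ => sobolevModTerm_nonneg s ξ h
  -- Up to constants, √V balances l R₀² against V / l; the term 1 / (N + 1) keeps l positive if V
  -- vanishes.
  set l : ℕ → ℝ := fun N => √(V N + 1 / ((N : ℝ) + 1)) with hl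
  have hpos : ∀ N, 0 < V N + 1 / ((N : ℝ) + 1) := fun N =>
    add_pos_of_nonneg_of_pos (hV0 N) (by positivity)
  have hl0 : ∀ N, 0 < l N := fun N => Real.sqrt_pos.mpr (hpos N)
  have hlt : Tendsto l atTop (𝓝 0) := by
    have h1 := ((tendsto_integral_sobolevMod hs).add
      (tendsto_one_div_add_atTop_nhds_zero_nat (𝕜 := ℝ))).sqrt
    rwa [zero_add, Real.sqrt_zero] at h1
  refine ⟨fun N => l N * ((R₀ ^ 2 + 1) / 2), by simpa using hlt.mul_const ((R₀ ^ 2 + 1) / 2),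
    fun N => ⟨fun h => l N / 2 * R₀ ^ 2 + (2 * l N)⁻¹ * sobolevMod s h, ?_, ?_,
      fun u hu h x => abs_sub_le_of_mem_sobolevBall hs hR hu (hl0 N) h x⟩⟩
  · exact integrable_torus _ (continuous_const.add (continuous_const.mul (continuous_sobolevMod hs)))
  · rw [integral_add (integrable_const _)
      ((integrable_torus _ (continuous_sobolevMod hs)).const_mul _)]
    have h1 : V N ≤ l N ^ 2 := by
      rw [hl, Real.sq_sqrt (hpos N).le]
      exact le_add_of_nonneg_right (by positivity)
    have h2 : (2 * l N)⁻¹ * V N ≤ l N / 2 := by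
      rw [inv_mul_le_iff₀ (by have := hl0 N; positivity)]
      linarith
    simp only [integral_const, probReal_univ, smul_eq_mul, one_mul]
    rw [integral_const_mul]
    change (2 * l N)⁻¹ * ∫ h, sobolevMod s h ∂(fejerLaw d N) ≤ l N / 2 at h2
    linarith

/-! ### Risks -/

section Risk

variable {d : ℕ} {R M L T δ s₀ R₀ : ℝ} {P : Measure C(Torus d, ℝ)}
  {μ : Measure (Torus d × ℝ)}

lemma ae_mem_of_isDataLaw (hlaw : IsDataLaw s₀ R₀ T P μ) :
    ∀ᵐ p ∂(P.prod μ), p.1 ∈ sobolevBall d s₀ R₀ ∧ p.2.2 ∈ Set.Icc 0 T := by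
  obtain ⟨hP, hP0, hμ, hμ0⟩ := hlaw
  have h1 : ∀ᵐ u ∂P, u ∈ sobolevBall d s₀ R₀ := hP0
  have h2 : ∀ᵐ z ∂μ, z ∈ cylinder d T := hμ0
  filter_upwards [Measure.quasiMeasurePreserving_fst.ae h1,
    Measure.quasiMeasurePreserving_snd.ae h2] with p hp1 hp2
  exact ⟨hp1, Set.Ioo_subset_Icc_self hp2.2⟩

lemma measurableSet_opDomain : MeasurableSet (opDomain d R T) := by
  refine MeasurableSet.prod ?_ (MeasurableSet.univ.prod measurableSet_Icc)
  exact (isClosed_le continuous_norm continuous_const).measurableSet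

/-- `opDomain` is measurable and has full mass, so continuity there gives measurability; the
integrand is at most (2M)². -/
lemma integrable_sqErr (hsub : sobolevBall d s₀ R₀ ⊆ initialBall d R)
    (hlaw : IsDataLaw s₀ R₀ T P μ) {Γ G : C(Torus d, ℝ) → ℝ → Torus d → ℝ}
    (hΓ : ContinuousOn (fun p : C(Torus d, ℝ) × (Torus d × ℝ) => Γ p.1 p.2.2 p.2.1)
      (opDomain d R T))
    (hG : ContinuousOn (fun p : C(Torus d, ℝ) × (Torus d × ℝ) => G p.1 p.2.2 p.2.1)
      (opDomain d R T))
    (hΓM : ∀ u ∈ initialBall d R, Γ u ∈ solutionBall d T M)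
    (hGM : ∀ u ∈ initialBall d R, G u ∈ solutionBall d T M) :
    Integrable (sqErr Γ G) (P.prod μ) := by
  have hmem := ae_mem_of_isDataLaw hlaw
  obtain ⟨hP, -, hμ, -⟩ := hlaw
  have hc : ContinuousOn (sqErr Γ G) (opDomain d R T) := (hΓ.sub hG).abs.pow 2
  have hm := hc.aestronglyMeasurable (μ := P.prod μ) measurableSet_opDomain
  rw [Measure.restrict_eq_self_of_ae_mem] at hm
  · refine Integrable.of_bound hm ((2 * M) ^ 2) ?_
    filter_upwards [hmem] with p hp
    have h1 := (hΓM _ (hsub hp.1)).2 _ hp.2 p.2.1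
    have h2 := (hGM _ (hsub hp.1)).2 _ hp.2 p.2.1
    rw [sqErr, Real.norm_of_nonneg (by positivity)]
    have h3 := abs_sub (Γ p.1 p.2.2 p.2.1) (G p.1 p.2.2 p.2.1)
    gcongr
    linarith
  · filter_upwards [hmem] with p hp
    exact ⟨hsub hp.1, trivial, hp.2⟩

/-- Difference of squares: the sum of the two errors is at most 4M, and their difference does not
involve the target. -/
lemma abs_risk_sub_le (hsub : sobolevBall d s₀ R₀ ⊆ initialBall d R)
    (hlaw : IsDataLaw s₀ R₀ T P μ) {Γ Γ' G : C(Torus d, ℝ) → ℝ → Torus d → ℝ}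
    (hΓM : ∀ u ∈ initialBall d R, Γ u ∈ solutionBall d T M)
    (hΓM' : ∀ u ∈ initialBall d R, Γ' u ∈ solutionBall d T M)
    (hGM : ∀ u ∈ initialBall d R, G u ∈ solutionBall d T M)
    (h1 : Integrable (sqErr Γ G) (P.prod μ)) (h2 : Integrable (sqErr Γ' G) (P.prod μ)) {B : ℝ}
    (hB : ∀ u ∈ sobolevBall d s₀ R₀, ∀ t ∈ Set.Icc 0 T, ∀ x, |Γ u t x - Γ' u t x| ≤ B) :
    |risk P μ G Γ - risk P μ G Γ'| ≤ 4 * M * B := by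
  have hmem := ae_mem_of_isDataLaw hlaw
  obtain ⟨hP, -, hμ, -⟩ := hlaw
  rw [risk, risk, ← integral_sub h1 h2]
  have h3 : ∀ᵐ p ∂(P.prod μ), ‖sqErr Γ G p - sqErr Γ' G p‖ ≤ 4 * M * B := by
    filter_upwards [hmem] with p hp
    have a1 := (hΓM _ (hsub hp.1)).2 _ hp.2 p.2.1
    have a2 := (hΓM' _ (hsub hp.1)).2 _ hp.2 p.2.1
    have a3 := (hGM _ (hsub hp.1)).2 _ hp.2 p.2.1
    have a4 := hB _ hp.1 _ hp.2 p.2.1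
    rw [sqErr, sqErr, sq_abs, sq_abs, sq_sub_sq, Real.norm_eq_abs, abs_mul, sub_sub_sub_cancel_right]
    refine mul_le_mul ?_ a4 (abs_nonneg _) ?_
    · rw [abs_le] at a1 a2 a3 ⊢
      constructor <;> linarith
    · linarith [abs_nonneg (Γ p.1 p.2.2 p.2.1)]
  have h4 := norm_integral_le_of_norm_le_const h3
  simpa using h4

end Risk

/-! ### Splitting into network and cutoff error -/

lemma Approximates.mem_nonlinClass {M L η : ℝ} {F : ℝ → ℝ} {ρ : ReLUNet 1}
    (h : Approximates M L η F ρ) : ρ.fn ∈ nonlinClass M L :=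
  ⟨h.2.1, h.2.2⟩

lemma one_sub_pow_div_le {δ : ℝ} (h0 : 0 ≤ δ) (h1 : δ < 1) (ℓ : ℕ) :
    (1 - δ ^ ℓ) / (1 - δ) ≤ (1 - δ)⁻¹ := by
  rw [div_eq_mul_inv]
  exact mul_le_of_le_one_left (inv_nonneg.mpr (sub_pos.mpr h1).le)
    (sub_le_self _ (pow_nonneg h0 _))

/-- The error of the Fourier neural operator splits into the error of the network and a cutoff
error that tends to zero uniformly in the number of Picard steps. -/
lemma exists_fno_error_bound {d : ℕ} {s₀ R₀ R M L T δ : ℝ} (hs : (d : ℝ) / 2 < s₀) (hR₀ : 0 ≤ R₀)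
    (h : Admissible R M L T δ) (hsub : sobolevBall d s₀ R₀ ⊆ initialBall d R) :
    ∃ a : ℕ → ℝ, Tendsto a atTop (𝓝 0) ∧ ∀ (ℓ : ℕ) (η : ℝ) (F : ℝ → ℝ) (ρ : ReLUNet 1),
      F ∈ nonlinClass M L → Approximates M L η F ρ → ∀ N, ∀ u₀ ∈ sobolevBall d s₀ R₀,
        ∀ t ∈ Set.Icc 0 T, ∀ x, |fno N ℓ ρ u₀ t x - picardIter F ℓ u₀ t x| ≤
          (1 - δ ^ ℓ) / (1 - δ) * T * η + a N := by
  obtain ⟨b, hb, hω⟩ := exists_cutoff_bound (d := d) hs hR₀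
  have h1 := h.one_sub_pos
  -- One factor comes from the inherited modulus, the other bounds the geometric sum for every ℓ.
  refine ⟨fun N => (1 - δ)⁻¹ * ((1 - δ)⁻¹ * b N), by simpa using (hb.const_mul _).const_mul _, ?_⟩
  intro ℓ η F ρ hF hρ N u₀ hu t ht x
  obtain ⟨ω, hint, hle, hmod⟩ := hω N
  rw [fno_eq h hρ.mem_nonlinClass (hsub hu) N ℓ t ht x, picardIter_eq h hF (hsub hu) ℓ t ht x]
  refine (avgIter_error h hF hρ.mem_nonlinClass (fejerLaw d N) hρ.1 (hsub hu) hint (hmod u₀ hu) ℓ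
    t ht x).trans ?_
  have hω0 : 0 ≤ ∫ s, ω s ∂(fejerLaw d N) :=
    integral_nonneg fun s => (abs_nonneg _).trans (hmod u₀ hu s 0)
  have h2 : (1 - δ ^ ℓ) / (1 - δ) * ((1 - δ)⁻¹ * ∫ s, ω s ∂(fejerLaw d N))
      ≤ (1 - δ)⁻¹ * ((1 - δ)⁻¹ * b N) := by
    have h3 := one_sub_pow_div_le h.nonneg h.lt_one ℓ
    gcongr
  rw [mul_add, ← mul_assoc]
  exact add_le_add le_rfl h2

end PicardFNO

/-! ### Assembly of the theorem -/

open PicardFNO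
theorem theorem6p2 :
    ∃ C : ℝ, 0 < C ∧
    ∀ (d : ℕ) (s₀ R₀ R M L T δ : ℝ), 1 ≤ d → (d : ℝ) / 2 < s₀ → 0 ≤ R₀ →
      0 < R → 0 < M → 0 < L → 0 < T → R + T * L * M ≤ M → T * L ≤ δ → δ < 1 →
      sobolevBall d s₀ R₀ ⊆ initialBall d R →
      -- the objects below are well defined
      (∀ F ∈ nonlinClass M L, ∀ u₀ ∈ initialBall d R,
        (∀ ℓ, picardIter F ℓ u₀ ∈ solutionBall d T M) ∧
        IsMildSolution T M F u₀ (solOp T M F u₀) ∧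
        ∀ u, IsMildSolution T M F u₀ u → ∀ t ∈ Set.Icc 0 T, ∀ x, u t x = solOp T M F u₀ t x) ∧
      -- approximation of the nonlinearity by a network of controlled size
      (∀ η ∈ Set.Ioo (0 : ℝ) 1, ∀ F ∈ nonlinClass M L, ∃ ρ : ReLUNet 1,
        Approximates M L η F ρ ∧ (ρ.size : ℝ) ≤ C * (1 + M * L * η⁻¹)) ∧
      -- for every choice of approximating networks: the error bounds
      (∀ ℓ : ℕ, ∃ a : ℕ → ℝ, Tendsto a atTop (𝓝 0) ∧
        ∀ η ∈ Set.Ioo (0 : ℝ) 1, ∀ ρ : (ℝ → ℝ) → ReLUNet 1,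
          (∀ F ∈ nonlinClass M L, Approximates M L η F (ρ F)) → ∀ N : ℕ,
          (∀ F ∈ nonlinClass M L, ∀ u₀ ∈ initialBall d R,
            fno N ℓ (ρ F) u₀ ∈ solutionBall d T M) ∧
          (∀ F ∈ nonlinClass M L, ∀ u₀ ∈ sobolevBall d s₀ R₀, ∀ t ∈ Set.Icc 0 T, ∀ x,
            |fno N ℓ (ρ F) u₀ t x - picardIter F ℓ u₀ t x| ≤
              (1 - δ ^ ℓ) / (1 - δ) * T * η + a N) ∧
          ∀ (P : Measure C(Torus d, ℝ)) (μ : Measure (Torus d × ℝ)), IsDataLaw s₀ R₀ T P μ →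
            ∀ Fstar ∈ nonlinClass M L,
              (∀ F ∈ nonlinClass M L,
                Integrable (sqErr (fno N ℓ (ρ F)) (solOp T M Fstar)) (P.prod μ) ∧
                Integrable (sqErr (picardIter F ℓ) (solOp T M Fstar)) (P.prod μ)) ∧
              implError M L P μ (solOp T M Fstar) N ℓ ρ ≤
                ENNReal.ofReal (4 * M * ((1 - δ ^ ℓ) / (1 - δ) * T * η + a N))) ∧
      -- the implementation error becomes arbitrarily small
      (∀ ε > 0, ∃ η₀ ∈ Set.Ioo (0 : ℝ) 1, ∀ η ∈ Set.Ioc 0 η₀, ∀ ℓ : ℕ, ∃ N₀ : ℕ, ∀ N ≥ N₀,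
        ∀ ρ : (ℝ → ℝ) → ReLUNet 1,
          (∀ F ∈ nonlinClass M L, Approximates M L η F (ρ F)) →
          ∀ (P : Measure C(Torus d, ℝ)) (μ : Measure (Torus d × ℝ)), IsDataLaw s₀ R₀ T P μ →
            ∀ Fstar ∈ nonlinClass M L,
              implError M L P μ (solOp T M Fstar) N ℓ ρ ≤ ENNReal.ofReal ε) := by
  refine ⟨25, by norm_num, ?_⟩
  intro d s₀ R₀ R M L T δ _ hs hR₀ hR hM hL hT hself hTL hδ hsub
  have h : Admissible R M L T δ := ⟨hR, hM, hL, hT, hself, hTL, hδ⟩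
  have hpos := h.one_sub_pos
  obtain ⟨a, ha, hbound⟩ := exists_fno_error_bound hs hR₀ h hsub
  have hGM : ∀ F ∈ nonlinClass M L, ∀ u ∈ initialBall d R, solOp T M F u ∈ solutionBall d T M :=
    fun F hF u hu => (isMildSolution_solOp h hF hu).1
  have hintF : ∀ (N ℓ : ℕ) (ρ : ReLUNet 1), ρ.fn ∈ nonlinClass M L →
      ∀ (P : Measure C(Torus d, ℝ)) (μ : Measure (Torus d × ℝ)), IsDataLaw s₀ R₀ T P μ →
      ∀ Fstar ∈ nonlinClass M L, Integrable (sqErr (fno N ℓ ρ) (solOp T M Fstar)) (P.prod μ) :=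
    fun N ℓ ρ hρ P μ hlaw Fstar hFs => integrable_sqErr hsub hlaw (continuousOn_fno h hρ N ℓ)
      (continuousOn_solOp h hFs) (fun u hu => fno_mem h hρ hu N ℓ) (hGM Fstar hFs)
  have hintP : ∀ (ℓ : ℕ), ∀ F ∈ nonlinClass M L,
      ∀ (P : Measure C(Torus d, ℝ)) (μ : Measure (Torus d × ℝ)), IsDataLaw s₀ R₀ T P μ →
      ∀ Fstar ∈ nonlinClass M L,
        Integrable (sqErr (picardIter F ℓ) (solOp T M Fstar)) (P.prod μ) :=
    fun ℓ F hF P μ hlaw Fstar hFs => integrable_sqErr hsub hlaw (continuousOn_picardIter h hF ℓ)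
      (continuousOn_solOp h hFs) (fun u hu => picardIter_mem h hF hu ℓ) (hGM Fstar hFs)
  have himpl : ∀ (ℓ : ℕ) (η : ℝ) (ρ : (ℝ → ℝ) → ReLUNet 1),
      (∀ F ∈ nonlinClass M L, Approximates M L η F (ρ F)) → ∀ N,
      ∀ (P : Measure C(Torus d, ℝ)) (μ : Measure (Torus d × ℝ)), IsDataLaw s₀ R₀ T P μ →
      ∀ Fstar ∈ nonlinClass M L, implError M L P μ (solOp T M Fstar) N ℓ ρ ≤
        ENNReal.ofReal (4 * M * ((1 - δ ^ ℓ) / (1 - δ) * T * η + a N)) := by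
    intro ℓ η ρ hρ N P μ hlaw Fstar hFs
    refine iSup₂_le fun F hF => ENNReal.ofReal_le_ofReal ?_
    have hmem := (hρ F hF).mem_nonlinClass
    exact abs_risk_sub_le hsub hlaw (fun u hu => fno_mem h hmem hu N ℓ)
      (fun u hu => picardIter_mem h hF hu ℓ) (hGM Fstar hFs)
      (hintF N ℓ _ hmem P μ hlaw Fstar hFs) (hintP ℓ F hF P μ hlaw Fstar hFs)
      (hbound ℓ η F (ρ F) hF (hρ F hF) N)
  refine ⟨fun F hF u₀ hu => ⟨picardIter_mem h hF hu, isMildSolution_solOp h hF hu,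
    fun u hsol => eq_solOp h hF hu hsol⟩, fun η hη F hF => exists_approximates hM hL hη.1 hF,
    fun ℓ => ⟨a, ha, fun η hη ρ hρ N => ⟨fun F hF u₀ hu => fno_mem h (hρ F hF).mem_nonlinClass hu N ℓ,
      fun F hF => hbound ℓ η F (ρ F) hF (hρ F hF) N, fun P μ hlaw Fstar hFs =>
        ⟨fun F hF => ⟨hintF N ℓ _ (hρ F hF).mem_nonlinClass P μ hlaw Fstar hFs,
          hintP ℓ F hF P μ hlaw Fstar hFs⟩, himpl ℓ η ρ hρ N P μ hlaw Fstar hFs⟩⟩⟩, ?_⟩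
  intro ε hε
  -- With this η the network part contributes at most ε / 2 after multiplication by 4M, for every ℓ;
  -- the cutoff part gets the other half.
  have hη₁ : 0 < ε * (1 - δ) / (8 * M * T) := by positivity
  refine ⟨min (1 / 2) (ε * (1 - δ) / (8 * M * T)), ⟨lt_min (by norm_num) hη₁,
    (min_le_left _ _).trans_lt (by norm_num)⟩, fun η hη ℓ => ?_⟩
  have hsmall : ∀ᶠ N in atTop, a N < ε / (8 * M) := ha.eventually_lt_const (by positivity)
  obtain ⟨N₀, hN₀⟩ := eventually_atTop.mp hsmall
  refine ⟨N₀, fun N hN ρ hρ P μ hlaw Fstar hFs =>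
    (himpl ℓ η ρ hρ N P μ hlaw Fstar hFs).trans (ENNReal.ofReal_le_ofReal ?_)⟩
  have hη₂ : η ≤ ε * (1 - δ) / (8 * M * T) := hη.2.trans (min_le_right _ _)
  have hη₀ : 0 < η := hη.1
  have h1 : (1 - δ ^ ℓ) / (1 - δ) * T * η ≤ ε / (8 * M) :=
    calc (1 - δ ^ ℓ) / (1 - δ) * T * η
        ≤ (1 - δ)⁻¹ * T * (ε * (1 - δ) / (8 * M * T)) := by
          have := one_sub_pow_div_le h.nonneg h.lt_one ℓ
          gcongr
      _ = ε / (8 * M) := by field_simp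
  calc 4 * M * ((1 - δ ^ ℓ) / (1 - δ) * T * η + a N)
      ≤ 4 * M * (ε / (8 * M) + ε / (8 * M)) := by
        have := (hN₀ N hN).le
        gcongr
    _ = ε := by field_simp; norm_num
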